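/- Let $a,c>0$ be real and let $p(z_1,z_2)=a-z_1+cz_2$. Suppose that $p$ has no zeros in the bidisk $\mathbb{D}^2$ and that $p$ has a zero on the torus $\mathbb{T}^2$. Let $$\tilde p(z_1,z_2)=z_1z_2\,\overline{p\!\left(1/\bar z_1,1/\bar z_2\right)}=a z_1z_2-z_2+c z_1,\qquad \theta_1=\frac{\tilde p}{p},\qquad \Theta=\theta_1^2,$$ and let $\mathcal{K}_\Theta=H^2(\mathbb{D}^2)\ominus\Theta H^2(\mathbb{D}^2)$ be the associated model space in the Hardy space of the bidisk. Let $\mathcal{K}_\Theta=\mathcal{S}_1\oplus\mathcal{S}_2$ be any orthogonal decomposition into closed subspaces such that $\mathcal{S}_1$ is invariant under $M_{z_1}$ (multiplication by $z_1$) and $\mathcal{S}_2$ is invariant under $M_{z_2}$ (multiplication by $z_2$). Let $$S^1_\Theta=P_{\mathcal{S}_2}M_{z_1}|_{\mathcal{S}_2},$$ where $P_{\mathcal{S}_2}$ is the orthogonal projection onto $\mathcal{S}_2$, and let $\mathcal{W}(S^1_\Theta)=\{\langle S^1_\Theta h,h\rangle : h\in\mathcal{S}_2,\ \|h\|=1\}$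 be its numerical range. Then the closure of $\mathcal{W}(S^1_\Theta)$ is not a circular disk: it is not equal to $\{z\in\mathbb{C}:|z-w|\le r\}$ for any $w\in\mathbb{C}$ and $r\in\mathbb{R}$. -/

import Mathlib

open MeasureTheory
open scoped ENNReal ComplexConjugate

noncomputable section

namespace BidiskShift

/-! ### The Hardy space of the bidisk -/

/-- The two-torus `𝕋²`, parametrized by `x ↦ (exp (2πi x₀), exp (2πi x₁))`. -/
abbrev Torus : Type := UnitAddTorus (Fin 2)

/-- Normalized Lebesgue measure `σ × σ` on `𝕋²`. -/
def torusMeasure : Measure Torus := Measure.pi fun _ => AddCircle.haarAddCircle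

instance : IsProbabilityMeasure torusMeasure := by
  unfold torusMeasure; infer_instance

/-- The Hilbert space `L²(𝕋²)`. -/
abbrev L2Torus : Type := Lp ℂ 2 torusMeasure

/-- The coordinate functions `z₁` (index `0`) and `z₂` (index `1`) on `𝕋²`. -/
def coord (j : Fin 2) : C(Torus, ℂ) where
  toFun x := ((x j).toCircle : ℂ)
  continuous_toFun :=
    continuous_induced_dom.comp (AddCircle.continuous_toCircle.comp (continuous_apply j))

/-- The monomial `z₁ ^ m * z₂ ^ n` as an element of `L²(𝕋²)`. -/
def monomial (m n : ℕ) : L2Torus :=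
  ContinuousMap.toLp 2 torusMeasure ℂ (coord 0 ^ m * coord 1 ^ n)

/-- The Hardy space `H²(𝔻²)`, identified through boundary values with the closed linear span in
`L²(𝕋²)` of the monomials `z₁ ^ m * z₂ ^ n`, `m, n ≥ 0`. -/
def hardy : Submodule ℂ L2Torus :=
  (Submodule.span ℂ (Set.range fun k : ℕ × ℕ => monomial k.1 k.2)).topologicalClosure

/-- Multiplication by a continuous function on `L²(𝕋²)`. -/
def mulOp (φ : C(Torus, ℂ)) : L2Torus →L[ℂ] L2Torus :=
  (ContinuousLinearMap.mul ℂ ℂ).holderL torusMeasure ∞ 2 2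
    (ContinuousMap.toLp ∞ torusMeasure ℂ φ)

theorem mulOp_coeFn (φ : C(Torus, ℂ)) (f : L2Torus) :
    mulOp φ f =ᵐ[torusMeasure] fun x => φ x * f x := by
  have h := (ContinuousLinearMap.mul ℂ ℂ).coeFn_holder (r := 2)
    (ContinuousMap.toLp ∞ torusMeasure ℂ φ) f
  filter_upwards [h, ContinuousMap.coeFn_toLp (p := ∞) (𝕜 := ℂ) torusMeasure φ] with x hx hφ
  rw [mulOp, ContinuousLinearMap.holderL_apply_apply, hx, hφ]
  rfl

/-- `M_{z_j}`: multiplication by the coordinate `z_j`. -/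
def shift (j : Fin 2) : L2Torus →L[ℂ] L2Torus := mulOp (coord j)

/-! ### Model spaces and compressed shifts -/

/-- The subspace `Θ H²(𝔻²)`, where `Θ` is given by its boundary values on `𝕋²`. -/
def innerMultiples (Θ : Torus → ℂ) : Submodule ℂ L2Torus where
  carrier := {g | ∃ h ∈ hardy, g =ᵐ[torusMeasure] fun x => Θ x * h x}
  add_mem' := by
    rintro g₁ g₂ ⟨h₁, hh₁, e₁⟩ ⟨h₂, hh₂, e₂⟩
    refine ⟨h₁ + h₂, hardy.add_mem hh₁ hh₂, ?_⟩
    filter_upwards [e₁, e₂, Lp.coeFn_add g₁ g₂, Lp.coeFn_add h₁ h₂] with x a b c d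
    rw [c, d, Pi.add_apply, Pi.add_apply, a, b, mul_add]
  zero_mem' := by
    refine ⟨0, hardy.zero_mem, ?_⟩
    filter_upwards [Lp.coeFn_zero ℂ 2 torusMeasure] with x a
    rw [a, Pi.zero_apply, mul_zero]
  smul_mem' := by
    rintro s g ⟨h, hh, e⟩
    refine ⟨s • h, hardy.smul_mem s hh, ?_⟩
    filter_upwards [e, Lp.coeFn_smul s g, Lp.coeFn_smul s h] with x a b c
    rw [b, c, Pi.smul_apply, Pi.smul_apply, a, smul_eq_mul, smul_eq_mul]
    ring

/-- The two-variable model space `K_Θ = H²(𝔻²) ⊖ Θ H²(𝔻²)`. -/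
def modelSpace (Θ : Torus → ℂ) : Submodule ℂ L2Torus := hardy ⊓ (innerMultiples Θ)ᗮ

/-- `K_Θ = S₁ ⊕ S₂` is an orthogonal decomposition into closed subspaces such that `S₁` is
`M_{z₁}`-invariant and `S₂` is `M_{z₂}`-invariant. -/
structure IsShiftDecomposition (Θ : Torus → ℂ) (S₁ S₂ : Submodule ℂ L2Torus) : Prop where
  isClosed₁ : IsClosed (S₁ : Set L2Torus)
  isClosed₂ : IsClosed (S₂ : Set L2Torus)
  orthogonal : S₁ ⟂ S₂
  sup_eq : S₁ ⊔ S₂ = modelSpace Θ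
  invariant₁ : ∀ f ∈ S₁, shift 0 f ∈ S₁
  invariant₂ : ∀ f ∈ S₂, shift 1 f ∈ S₂

/-- The compressed shift `P_S M_{z₁} |_S` on a closed subspace `S`. -/
def compressedShift (S : Submodule ℂ L2Torus) [S.HasOrthogonalProjection] : S →L[ℂ] S :=
  S.orthogonalProjectionOnto ∘L shift 0 ∘L S.subtypeL

/-- The numerical range `{⟨T h, h⟩ : ‖h‖ = 1}` of a bounded operator. (Mathlib's inner product is
linear in its second argument.) -/
def numericalRange {H : Type*} [NormedAddCommGroup H] [InnerProductSpace ℂ H]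
    (T : H →L[ℂ] H) : Set ℂ :=
  {w | ∃ h : H, ‖h‖ = 1 ∧ w = inner ℂ h (T h)}

/-! ### Rational functions of degree `(1,1)` -/

/-- The polynomial `a + b z₁ + c z₂ + d z₁ z₂`. -/
def biaffine (a b c d z₁ z₂ : ℂ) : ℂ := a + b * z₁ + c * z₂ + d * (z₁ * z₂)

/-- The reflection `z₁ z₂ * conj (p (1 / conj z₁, 1 / conj z₂))` at bidegree `(1,1)` of the
polynomial `p = a + b z₁ + c z₂ + d z₁ z₂`. -/
def biaffineReflection (a b c d z₁ z₂ : ℂ) : ℂ :=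
  conj a * (z₁ * z₂) + conj b * z₂ + conj c * z₁ + conj d

theorem biaffineReflection_eq (a b c d z₁ z₂ : ℂ) (h₁ : z₁ ≠ 0) (h₂ : z₂ ≠ 0) :
    biaffineReflection a b c d z₁ z₂ =
      z₁ * z₂ * conj (biaffine a b c d (1 / conj z₁) (1 / conj z₂)) := by
  simp only [biaffine, biaffineReflection, map_add, map_mul, map_div₀, map_one,
    Complex.conj_conj]
  field_simp

/-- The polynomial `p = a - z₁ + c z₂`. -/
def poly (a c : ℝ) (z₁ z₂ : ℂ) : ℂ := biaffine a (-1) c 0 z₁ z₂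

/-- The reflection of `p = a - z₁ + c z₂`. -/
def polyReflection (a c : ℝ) (z₁ z₂ : ℂ) : ℂ := biaffineReflection a (-1) c 0 z₁ z₂

/-- The rational function `θ₁`, the reflection of `p = a - z₁ + c z₂` divided by `p`. -/
def theta (a c : ℝ) (z₁ z₂ : ℂ) : ℂ := polyReflection a c z₁ z₂ / poly a c z₁ z₂

/-- The boundary values on `𝕋²` of `Θ = θ₁²`. -/
def bigTheta (a c : ℝ) (x : Torus) : ℂ := theta a c (coord 0 x) (coord 1 x) ^ 2

end BidiskShift

end

noncomputable section

namespace BidiskShift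

open Filter Topology

/-! ### The algebra of continuous multipliers on `L²(𝕋²)` -/

/-! The zero conditions force a = 1 + c, so p vanishes at (1, -1). Put q = 1 + c + c z₂, so p = q -
z₁, and y = 1 + z₂. For fixed z₂ ≠ -1 on the circle, Θ is in z₁ a unimodular multiple of the square
of a Blaschke factor with zero λ = 1/q̄. The model operator of such a square has as numerical range
the closed disk with centre λ and radius (1 - |λ|²)/2. As z₂ → -1 these fibre disks shrink to the
point 1.

To see the fibre disks inside the range of the compressed shift, one needs explicit elements of S₂:
for every decomposition, e = y⁴/p² and z₁e lie in S₂ (`mem_of_isShiftDecomposition`). Hence so do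
g(z₂) q² (p + β p̃) e for polynomials g. Their norms and quadratic forms reduce to integrals of |g|²
against explicit densities on the z₂-circle, and letting |g|² peak at a point gives a support
inequality (`two_norm_add_le`).

Suppose the closed range is the disk D(w, r). It lies in the unit disk, so |w| + r ≤ 1. Near z₂ = -1
the fibre disks come so close to the unit circle that w = 0 and r ≥ 1
(`center_eq_zero_and_one_le_radius`). Then -1 is in the closed range. But 1 + z₁ is bounded below on
S₂ (`exists_norm_le_mul_norm_add_shift`), because p²h has z₁-degree at most 1 for h in S₂ and p does
not vanish near z₁ = -1; this excludes -1. -/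

theorem mulOp_mul (φ ψ : C(Torus, ℂ)) (f : L2Torus) :
    mulOp (φ * ψ) f = mulOp φ (mulOp ψ f) := by
  refine Lp.ext ?_
  filter_upwards [mulOp_coeFn (φ * ψ) f, mulOp_coeFn φ (mulOp ψ f), mulOp_coeFn ψ f]
    with x h1 h2 h3
  rw [h1, h2, h3, ContinuousMap.mul_apply, mul_assoc]

theorem mulOp_add (φ ψ : C(Torus, ℂ)) (f : L2Torus) :
    mulOp (φ + ψ) f = mulOp φ f + mulOp ψ f := by
  refine Lp.ext ?_
  filter_upwards [mulOp_coeFn (φ + ψ) f, mulOp_coeFn φ f, mulOp_coeFn ψ f,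
    Lp.coeFn_add (mulOp φ f) (mulOp ψ f)] with x h1 h2 h3 h4
  rw [h1, h4, Pi.add_apply, h2, h3, ContinuousMap.add_apply, add_mul]

theorem mulOp_smul (s : ℂ) (φ : C(Torus, ℂ)) (f : L2Torus) :
    mulOp (s • φ) f = s • mulOp φ f := by
  refine Lp.ext ?_
  filter_upwards [mulOp_coeFn (s • φ) f, mulOp_coeFn φ f, Lp.coeFn_smul s (mulOp φ f)]
    with x h1 h2 h3
  rw [h1, h3, Pi.smul_apply, h2, ContinuousMap.smul_apply, smul_eq_mul, smul_eq_mul, mul_assoc]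

theorem mulOp_one (f : L2Torus) : mulOp 1 f = f := by
  refine Lp.ext ?_
  filter_upwards [mulOp_coeFn 1 f] with x h1
  rw [h1, ContinuousMap.one_apply, one_mul]

theorem mulOp_sub (φ ψ : C(Torus, ℂ)) (f : L2Torus) :
    mulOp (φ - ψ) f = mulOp φ f - mulOp ψ f := by
  have h := mulOp_add (φ - ψ) ψ f
  rw [sub_add_cancel] at h
  rw [h, add_sub_cancel_right]

theorem mulOp_comm (φ ψ : C(Torus, ℂ)) (f : L2Torus) :
    mulOp φ (mulOp ψ f) = mulOp ψ (mulOp φ f) := by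
  rw [← mulOp_mul, mul_comm, mulOp_mul]

theorem inner_eq_integral (f g : L2Torus) :
    inner ℂ f g = ∫ x, conj (f x) * g x ∂torusMeasure := by
  rw [L2.inner_def]
  refine integral_congr_ae (Eventually.of_forall fun x => ?_)
  simp [mul_comm]

theorem norm_sq_eq_integral (f : L2Torus) : ‖f‖ ^ 2 = ∫ x, ‖f x‖ ^ 2 ∂torusMeasure := by
  have h := inner_self_eq_norm_sq_to_K (𝕜 := ℂ) f
  rw [L2.inner_def] at h
  simp_rw [inner_self_eq_norm_sq_to_K] at h
  have h2 : ((∫ x, ‖f x‖ ^ 2 ∂torusMeasure : ℝ) : ℂ) = ((‖f‖ ^ 2 : ℝ) : ℂ) := by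
    rw [← integral_complex_ofReal]; simpa using h
  exact_mod_cast h2.symm

theorem integrable_norm_sq (f : L2Torus) :
    Integrable (fun x => ‖f x‖ ^ 2) torusMeasure :=
  (memLp_two_iff_integrable_sq_norm (Lp.aestronglyMeasurable f)).1 (Lp.memLp f)

theorem inner_mulOp (φ : C(Torus, ℂ)) (f g : L2Torus) :
    inner ℂ f (mulOp φ g) = inner ℂ (mulOp (star φ) f) g := by
  rw [inner_eq_integral, inner_eq_integral]
  refine integral_congr_ae ?_
  filter_upwards [mulOp_coeFn φ g, mulOp_coeFn (star φ) f] with x h1 h2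
  rw [h1, h2, ContinuousMap.star_apply, map_mul, starRingEnd_apply, starRingEnd_apply, star_star]
  ring

/-- The constant function `1`. -/
def constOne : L2Torus := monomial 0 0

theorem constOne_coeFn : constOne =ᵐ[torusMeasure] fun _ => 1 := by
  filter_upwards [ContinuousMap.coeFn_toLp (p := 2) (𝕜 := ℂ) torusMeasure
    (coord 0 ^ 0 * coord 1 ^ 0)] with x hx
  rw [constOne, monomial, hx]; simp

theorem mulOp_constOne_coeFn (φ : C(Torus, ℂ)) : mulOp φ constOne =ᵐ[torusMeasure] φ := by
  filter_upwards [mulOp_coeFn φ constOne, constOne_coeFn] with x h1 h2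
  rw [h1, h2, mul_one]

theorem monomial_eq_mulOp (m n : ℕ) :
    monomial m n = mulOp (coord 0 ^ m * coord 1 ^ n) constOne := by
  refine Lp.ext ?_
  filter_upwards [ContinuousMap.coeFn_toLp (p := 2) (𝕜 := ℂ) torusMeasure
    (coord 0 ^ m * coord 1 ^ n), mulOp_constOne_coeFn (coord 0 ^ m * coord 1 ^ n)] with x h1 h2
  rw [h2, monomial, h1]

/-- The mean value `∫ f` over the torus. -/
def mean : L2Torus →L[ℂ] ℂ := innerSL ℂ constOne

theorem mean_eq_integral (f : L2Torus) : mean f = ∫ x, f x ∂torusMeasure := by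
  rw [mean, innerSL_apply_apply, inner_eq_integral]
  refine integral_congr_ae ?_
  filter_upwards [constOne_coeFn] with x hx
  rw [hx, map_one, one_mul]

theorem inner_mulOp_constOne (φ : C(Torus, ℂ)) (f : L2Torus) :
    inner ℂ (mulOp φ constOne) f = mean (mulOp (star φ) f) := by
  rw [mean, innerSL_apply_apply, inner_mulOp, star_star]

/-! ### Division by `1 - t` for a contractive multiplier `t` -/

theorem tendsto_mulOp_pow {t : C(Torus, ℂ)} (ht : ∀ x, ‖t x‖ ≤ 1)
    (ht' : ∀ᵐ x ∂torusMeasure, ‖t x‖ < 1) (f : L2Torus) :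
    Tendsto (fun n : ℕ => mulOp (t ^ n) f) atTop (𝓝 0) := by
  rw [tendsto_zero_iff_norm_tendsto_zero]
  have key : Tendsto (fun n : ℕ => ‖mulOp (t ^ n) f‖ ^ 2) atTop (𝓝 0) := by
    have h0 : (0 : ℝ) = ∫ _ : Torus, (0 : ℝ) ∂torusMeasure := by simp
    rw [h0]
    have e : ∀ n : ℕ, ‖mulOp (t ^ n) f‖ ^ 2 =
        ∫ x, (‖t x‖ ^ n * ‖f x‖) ^ 2 ∂torusMeasure := by
      intro n
      rw [norm_sq_eq_integral]
      refine integral_congr_ae ?_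
      filter_upwards [mulOp_coeFn (t ^ n) f] with x hx
      rw [hx, norm_mul, ContinuousMap.pow_apply, norm_pow]
    simp_rw [e]
    refine tendsto_integral_of_dominated_convergence (fun x => ‖f x‖ ^ 2) ?_
      (integrable_norm_sq f) ?_ ?_
    · intro n
      exact (((t.continuous.norm.pow n).aestronglyMeasurable).mul
        (Lp.aestronglyMeasurable f).norm).pow 2
    · intro n
      refine Eventually.of_forall fun x => ?_
      rw [Real.norm_of_nonneg (by positivity)]
      have := mul_le_of_le_one_left (norm_nonneg (f x)) (pow_le_one₀ (norm_nonneg _) (ht x) (n := n))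
      gcongr
    · filter_upwards [ht'] with x hx
      have := ((tendsto_pow_atTop_nhds_zero_of_lt_one (norm_nonneg _) hx).mul_const ‖f x‖).pow 2
      simpa using this
  have := key.sqrt
  simpa [Real.sqrt_sq] using this

/-- The elements f - tⁿf = ∑_{k<n} tᵏ(f - tf) lie in M and tend to f. This replaces division by 1 -
t, which may have zeros on the torus. -/
theorem mem_of_sub_mulOp_mem {M : Submodule ℂ L2Torus} (hM : IsClosed (M : Set L2Torus))
    {t : C(Torus, ℂ)} (ht : ∀ x, ‖t x‖ ≤ 1) (ht' : ∀ᵐ x ∂torusMeasure, ‖t x‖ < 1)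
    (hinv : ∀ f ∈ M, mulOp t f ∈ M) {f : L2Torus} (h : f - mulOp t f ∈ M) : f ∈ M := by
  have key : ∀ n : ℕ, f - mulOp (t ^ n) f ∈ M := by
    intro n
    induction n with
    | zero => rw [pow_zero, mulOp_one, sub_self]; exact M.zero_mem
    | succ n ih =>
      have : f - mulOp (t ^ (n + 1)) f = (f - mulOp t f) + mulOp t (f - mulOp (t ^ n) f) := by
        rw [map_sub, pow_succ', mulOp_mul]; abel
      rw [this]
      exact M.add_mem h (hinv _ ih)
  have lim : Tendsto (fun n : ℕ => f - mulOp (t ^ n) f) atTop (𝓝 (f - 0)) :=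
    tendsto_const_nhds.sub (tendsto_mulOp_pow ht ht' f)
  rw [sub_zero] at lim
  exact hM.mem_of_tendsto lim (Eventually.of_forall key)

/-! ### The coordinate functions -/

theorem norm_coord (j : Fin 2) (x : Torus) : ‖coord j x‖ = 1 := Circle.norm_coe _

theorem star_coord_mul_coord (j : Fin 2) : star (coord j) * coord j = 1 := by
  ext x
  rw [ContinuousMap.mul_apply, ContinuousMap.star_apply, ContinuousMap.one_apply,
    Complex.star_def, ← Complex.normSq_eq_conj_mul_self, Complex.normSq_eq_norm_sq, norm_coord]
  simp

theorem haarAddCircle_singleton (x : UnitAddCircle) :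
    (AddCircle.haarAddCircle : Measure UnitAddCircle) {x} = 0 := by
  have h := congrArg (fun m => m {x}) (AddCircle.volume_eq_smul_haarAddCircle (T := 1))
  have h2 : (volume : Measure UnitAddCircle) {x} = 0 := by
    have := AddCircle.volume_closedBall (T := 1) (x := x) 0
    simpa using this
  rw [h2] at h
  simpa using h.symm

instance : NullSingletonClass (AddCircle.haarAddCircle : Measure UnitAddCircle) :=
  ⟨haarAddCircle_singleton⟩

theorem ae_coord_zero_ne_one : ∀ᵐ x ∂torusMeasure, coord 0 x ≠ 1 := by
  have h : ∀ᵐ x ∂torusMeasure, x 0 ≠ 0 := by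
    rw [ae_iff]
    simp only [not_not]
    exact Measure.pi_hyperplane (fun _ : Fin 2 => AddCircle.haarAddCircle) 0 0
  filter_upwards [h] with x hx h1
  apply hx
  apply AddCircle.injective_toCircle one_ne_zero
  rw [AddCircle.toCircle_zero]
  exact Circle.ext h1

/-- A continuous function of the second coordinate, as a function on the torus. -/
def lift : C(UnitAddCircle, ℂ) →⋆ₐ[ℂ] C(Torus, ℂ) :=
  ContinuousMap.compStarAlgHom' ℂ ℂ ⟨fun x : Torus => x 1, continuous_apply 1⟩

theorem lift_apply (B : C(UnitAddCircle, ℂ)) (x : Torus) : lift B x = B (x 1) := rfl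

theorem lift_fourier_one : lift (fourier 1) = coord 1 := by
  ext x; rw [lift_apply, fourier_one]; rfl

theorem integral_toCircle_pow (n : ℕ) :
    ∫ t : UnitAddCircle, (t.toCircle : ℂ) ^ (n + 1) ∂AddCircle.haarAddCircle = 0 := by
  have h := (orthonormal_iff_ite.1 (orthonormal_fourier (T := 1))) 0 ((n : ℤ) + 1)
  rw [if_neg (by lia), ContinuousMap.inner_toLp] at h
  rw [← h]
  refine integral_congr_ae (Eventually.of_forall fun t => ?_)
  simp only [fourier_apply, zero_smul, AddCircle.toCircle_zero]
  have : ((n : ℤ) + 1) • t = (n + 1) • t := by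
    rw [← natCast_zsmul]; push_cast; rfl
  rw [this, AddCircle.toCircle_nsmul]
  simp

theorem integral_toCircle_pow_mul (m : ℕ) (B : C(UnitAddCircle, ℂ)) :
    ∫ x : Torus, (coord 0 x) ^ (m + 1) * B (x 1) ∂torusMeasure = 0 := by
  have h := integral_fintype_prod_eq_prod (𝕜 := ℂ)
    (μ := fun _ : Fin 2 => (AddCircle.haarAddCircle : Measure UnitAddCircle))
    (fun i t => if i = 0 then (t.toCircle : ℂ) ^ (m + 1) else B t)
  simp only [Fin.prod_univ_two] at h
  have h' := h
  simp only [if_true, Fin.isValue, one_ne_zero, if_false, integral_toCircle_pow, zero_mul] at h'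
  exact h'

/-! ### Functions in the Hardy space -/

theorem isClosed_hardy : IsClosed (hardy : Set L2Torus) :=
  Submodule.isClosed_topologicalClosure _

theorem monomial_mem_hardy (m n : ℕ) : monomial m n ∈ hardy :=
  Submodule.le_topologicalClosure _ (Submodule.subset_span ⟨(m, n), rfl⟩)

theorem hardy_le_of_monomial_mem {M : Submodule ℂ L2Torus} (hM : IsClosed (M : Set L2Torus))
    (h : ∀ m n, monomial m n ∈ M) : hardy ≤ M := by
  refine Submodule.topologicalClosure_minimal _ ?_ hM
  rw [Submodule.span_le]
  rintro _ ⟨k, rfl⟩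
  exact h _ _

theorem mean_coord_pow_mul_lift {f : L2Torus} (hf : f ∈ hardy) (m : ℕ)
    (B : C(UnitAddCircle, ℂ)) : mean (mulOp (coord 0 ^ (m + 1) * lift B) f) = 0 := by
  have h : hardy ≤ (mean ∘L mulOp (coord 0 ^ (m + 1) * lift B)).ker := by
    refine hardy_le_of_monomial_mem (ContinuousLinearMap.isClosed_ker _) fun i j => ?_
    rw [LinearMap.mem_ker]
    change mean (mulOp (coord 0 ^ (m + 1) * lift B) (monomial i j)) = 0
    rw [monomial_eq_mulOp, ← mulOp_mul, mean_eq_integral,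
      ← integral_toCircle_pow_mul (i + m) (B * fourier 1 ^ j)]
    refine integral_congr_ae ?_
    filter_upwards [mulOp_constOne_coeFn
      (coord 0 ^ (m + 1) * lift B * (coord 0 ^ i * coord 1 ^ j))] with x hx
    rw [hx, ← lift_fourier_one]
    simp only [ContinuousMap.mul_apply, ContinuousMap.pow_apply, lift_apply]
    ring
  exact h hf

/-- The analytic polynomials on the torus. -/
def analyticPolys : Subalgebra ℂ C(Torus, ℂ) := Algebra.adjoin ℂ (Set.range coord)

theorem coord_mem_analyticPolys (j : Fin 2) : coord j ∈ analyticPolys :=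
  Algebra.subset_adjoin ⟨j, rfl⟩

theorem shift_mem_hardy (j : Fin 2) {f : L2Torus} (hf : f ∈ hardy) : shift j f ∈ hardy := by
  have h : hardy ≤ hardy.comap (mulOp (coord j) : L2Torus →ₗ[ℂ] L2Torus) := by
    refine hardy_le_of_monomial_mem (isClosed_hardy.preimage (mulOp (coord j)).continuous) ?_
    intro m n
    rw [Submodule.mem_comap]
    change mulOp (coord j) (monomial m n) ∈ hardy
    rw [monomial_eq_mulOp, ← mulOp_mul]
    fin_cases j
    · have : coord 0 * (coord 0 ^ m * coord 1 ^ n) = coord 0 ^ (m + 1) * coord 1 ^ n := by ring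
      simp only [Fin.zero_eta, this, ← monomial_eq_mulOp, monomial_mem_hardy]
    · have : coord 1 * (coord 0 ^ m * coord 1 ^ n) = coord 0 ^ m * coord 1 ^ (n + 1) := by ring
      simp only [Fin.mk_one, this, ← monomial_eq_mulOp, monomial_mem_hardy]
  exact h hf

/-- A submodule invariant under a set of multipliers is invariant under the algebra they
generate. -/
theorem mulOp_mem_of_mem_adjoin {M : Submodule ℂ L2Torus} {s : Set C(Torus, ℂ)}
    (h : ∀ φ ∈ s, ∀ f ∈ M, mulOp φ f ∈ M) {φ : C(Torus, ℂ)} (hφ : φ ∈ Algebra.adjoin ℂ s) :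
    ∀ f ∈ M, mulOp φ f ∈ M := by
  induction hφ using Algebra.adjoin_induction with
  | mem φ hφ => exact h φ hφ
  | algebraMap r =>
    intro f hf
    rw [Algebra.algebraMap_eq_smul_one, mulOp_smul, mulOp_one]
    exact M.smul_mem r hf
  | add φ ψ _ _ h1 h2 =>
    intro f hf
    rw [mulOp_add]
    exact M.add_mem (h1 f hf) (h2 f hf)
  | mul φ ψ _ _ h1 h2 =>
    intro f hf
    rw [mulOp_mul]
    exact h1 _ (h2 f hf)

theorem mulOp_mem_hardy {φ : C(Torus, ℂ)} (hφ : φ ∈ analyticPolys) {f : L2Torus}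
    (hf : f ∈ hardy) : mulOp φ f ∈ hardy := by
  refine mulOp_mem_of_mem_adjoin ?_ hφ f hf
  rintro _ ⟨j, rfl⟩ f hf
  exact shift_mem_hardy j hf

/-! ### Subspaces of functions with one-sided spectrum -/

/-- Functions whose frequencies in the first coordinate are all strictly positive. -/
def positiveFreq : Submodule ℂ L2Torus where
  -- The mean against z₁ᵐB(z₂) detects frequency -m in z₁; including m = 0 makes the positivity
  -- strict.
  carrier := {f | ∀ (m : ℕ) (B : C(UnitAddCircle, ℂ)), mean (mulOp (coord 0 ^ m * lift B) f) = 0}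
  add_mem' := by
    intro f g hf hg m B
    rw [map_add, map_add, hf, hg, add_zero]
  zero_mem' := by
    intro m B
    rw [map_zero, map_zero]
  smul_mem' := by
    intro s f hf m B
    rw [map_smul, map_smul, hf, smul_zero]

theorem mean_eq_zero_of_mem_positiveFreq {f : L2Torus} (hf : f ∈ positiveFreq) : mean f = 0 := by
  have := hf 0 1
  rwa [pow_zero, one_mul, map_one, mulOp_one] at this

theorem mulOp_coord_zero_mem_positiveFreq {f : L2Torus} (hf : f ∈ hardy) :
    mulOp (coord 0) f ∈ positiveFreq := by
  intro m B
  rw [← mulOp_mul, ← mean_coord_pow_mul_lift hf m B]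
  congr 3; ring

/-- The multipliers generated by `z₁` and all continuous functions of `z₂`. -/
def leftAnalytic : Subalgebra ℂ C(Torus, ℂ) := Algebra.adjoin ℂ ({coord 0} ∪ Set.range lift)

theorem coord_zero_mem_leftAnalytic : coord 0 ∈ leftAnalytic :=
  Algebra.subset_adjoin (Or.inl rfl)

theorem lift_mem_leftAnalytic (B : C(UnitAddCircle, ℂ)) : lift B ∈ leftAnalytic :=
  Algebra.subset_adjoin (Or.inr ⟨B, rfl⟩)

theorem coord_one_mem_leftAnalytic : coord 1 ∈ leftAnalytic := by
  rw [← lift_fourier_one]; exact lift_mem_leftAnalytic _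

theorem star_coord_one_mem_leftAnalytic : star (coord 1) ∈ leftAnalytic := by
  rw [← lift_fourier_one, ← map_star]; exact lift_mem_leftAnalytic _

theorem mulOp_mem_positiveFreq {φ : C(Torus, ℂ)} (hφ : φ ∈ leftAnalytic) {f : L2Torus}
    (hf : f ∈ positiveFreq) : mulOp φ f ∈ positiveFreq := by
  refine mulOp_mem_of_mem_adjoin ?_ hφ f hf
  rintro _ (rfl | ⟨A, rfl⟩) f hf m B
  · rw [← mulOp_mul, ← hf (m + 1) B]
    congr 3; ring
  · rw [← mulOp_mul, ← hf m (B * A), map_mul]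
    congr 3; ring

/-- The device that kills the error terms later on: a spare factor z₁ next to something analytic in
z₁ leaves no frequency 0, however the multiplier depends on z₂. -/
theorem mean_mulOp_mul_coord_zero {φ : C(Torus, ℂ)} (hφ : φ ∈ leftAnalytic) {f : L2Torus}
    (hf : f ∈ hardy) : mean (mulOp (φ * coord 0) f) = 0 := by
  rw [mulOp_mul]
  exact mean_eq_zero_of_mem_positiveFreq
    (mulOp_mem_positiveFreq hφ (mulOp_coord_zero_mem_positiveFreq hf))

/-- Functions whose frequencies in the `j`-th coordinate are all strictly negative. -/
def negativeFreq (j : Fin 2) : Submodule ℂ L2Torus where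
  -- Together `i` and `k` produce every integer power of the other coordinate.
  carrier := {f | ∀ i k n : ℕ,
    mean (mulOp (coord (1 - j) ^ i * star (coord (1 - j)) ^ k * star (coord j) ^ n) f) = 0}
  add_mem' := by
    intro f g hf hg i k n
    rw [map_add, map_add, hf, hg, add_zero]
  zero_mem' := by
    intro i k n
    rw [map_zero, map_zero]
  smul_mem' := by
    intro s f hf i k n
    rw [map_smul, map_smul, hf, smul_zero]

theorem mean_eq_zero_of_mem_negativeFreq {j : Fin 2} {f : L2Torus} (hf : f ∈ negativeFreq j) :
    mean f = 0 := by
  have := hf 0 0 0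
  simpa only [pow_zero, mul_one, mulOp_one] using this

/-- The multipliers with non-positive frequencies in the `j`-th coordinate. -/
def rightCoanalytic (j : Fin 2) : Subalgebra ℂ C(Torus, ℂ) :=
  Algebra.adjoin ℂ {coord (1 - j), star (coord (1 - j)), star (coord j)}

theorem mulOp_mem_negativeFreq {j : Fin 2} {φ : C(Torus, ℂ)} (hφ : φ ∈ rightCoanalytic j)
    {f : L2Torus} (hf : f ∈ negativeFreq j) : mulOp φ f ∈ negativeFreq j := by
  refine mulOp_mem_of_mem_adjoin ?_ hφ f hf
  rintro _ (rfl | rfl | rfl) f hf i k n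
  · rw [← mulOp_mul, ← hf (i + 1) k n]
    congr 3; ring
  · rw [← mulOp_mul, ← hf i (k + 1) n]
    congr 3; ring
  · rw [← mulOp_mul, ← hf i k (n + 1)]
    congr 3; ring

/-! ### The polynomial `p` on the torus -/

/-- `x = 1 - z₁`. -/
def xC : C(Torus, ℂ) := 1 - coord 0

/-- `y = 1 + z₂`. -/
def yC : C(Torus, ℂ) := 1 + coord 1

/-- The polynomial `p = 1 + c - z₁ + c z₂` on the torus. -/
def pC (c : ℝ) : C(Torus, ℂ) := (1 + c : ℂ) • 1 - coord 0 + (c : ℂ) • coord 1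

theorem coord_mul_conj (j : Fin 2) (x : Torus) : coord j x * conj (coord j x) = 1 := by
  rw [Complex.mul_conj, Complex.normSq_eq_norm_sq, norm_coord]; simp

theorem coord_re_im (j : Fin 2) (x : Torus) : (coord j x).re ^ 2 + (coord j x).im ^ 2 = 1 := by
  have := congrArg (· ^ 2) (norm_coord j x)
  simp only [Complex.sq_norm, Complex.normSq_apply, one_pow] at this
  linarith

theorem pC_apply (c : ℝ) (x : Torus) : pC c x = 1 + c - coord 0 x + c * coord 1 x := by
  simp [pC]

theorem xC_apply (x : Torus) : xC x = 1 - coord 0 x := by simp [xC]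

theorem yC_apply (x : Torus) : yC x = 1 + coord 1 x := by simp [yC]

/-- This controls |x|² and |y|² by |p|, so y²/p is bounded, and it shows that p can vanish on the
torus only at (1, -1). -/
theorem two_mul_re_pC (c : ℝ) (x : Torus) :
    2 * (pC c x).re = ‖xC x‖ ^ 2 + c * ‖yC x‖ ^ 2 := by
  rw [Complex.sq_norm, Complex.sq_norm, Complex.normSq_apply, Complex.normSq_apply,
    pC_apply, xC_apply, yC_apply]
  simp
  linear_combination -coord_re_im 0 x - c * coord_re_im 1 x

/-- Equivalently |p - (1 + c)| ≤ 1 + c, which is the triangle inequality for z₁ - c z₂. -/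
theorem norm_pC_sq_le {c : ℝ} (hc : 0 < c) (x : Torus) :
    ‖pC c x‖ ^ 2 ≤ 2 * (1 + c) * (pC c x).re := by
  rw [Complex.sq_norm, Complex.normSq_apply, pC_apply]
  simp
  have h0 := coord_re_im 0 x
  have h1 := coord_re_im 1 x
  have h : 0 ≤ c * (((coord 0 x).re + (coord 1 x).re) ^ 2 +
    ((coord 0 x).im + (coord 1 x).im) ^ 2) := by positivity
  linear_combination h + (1 + c) * h0 + (c ^ 2 + c) * h1

theorem c_mul_norm_yC_sq_le {c : ℝ} (x : Torus) : c * ‖yC x‖ ^ 2 ≤ 2 * ‖pC c x‖ := by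
  have h := two_mul_re_pC c x
  have h2 := Complex.re_le_norm (pC c x)
  nlinarith [sq_nonneg ‖xC x‖]

theorem norm_xC_sq_le {c : ℝ} (hc : 0 < c) (x : Torus) : ‖xC x‖ ^ 2 ≤ 2 * ‖pC c x‖ := by
  have h := two_mul_re_pC c x
  have h2 := Complex.re_le_norm (pC c x)
  have h3 : 0 ≤ c * ‖yC x‖ ^ 2 := by positivity
  linarith

theorem ae_re_pC_pos {c : ℝ} (hc : 0 < c) : ∀ᵐ x ∂torusMeasure, 0 < (pC c x).re := by
  filter_upwards [ae_coord_zero_ne_one] with x hx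
  have h := two_mul_re_pC c x
  have h2 : 0 < ‖xC x‖ ^ 2 := by
    have : xC x ≠ 0 := by rw [xC_apply]; exact sub_ne_zero.2 (Ne.symm hx)
    positivity
  have h3 : 0 ≤ c * ‖yC x‖ ^ 2 := by positivity
  linarith

theorem ae_pC_ne_zero {c : ℝ} (hc : 0 < c) : ∀ᵐ x ∂torusMeasure, pC c x ≠ 0 := by
  filter_upwards [ae_re_pC_pos hc] with x hx h
  rw [h] at hx
  simp at hx

theorem yC_mem_analyticPolys : yC ∈ analyticPolys :=
  add_mem (one_mem _) (coord_mem_analyticPolys 1)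

theorem pC_mem_analyticPolys (c : ℝ) : pC c ∈ analyticPolys :=
  add_mem (sub_mem (Subalgebra.smul_mem _ (one_mem _) _) (coord_mem_analyticPolys 0))
    (Subalgebra.smul_mem _ (coord_mem_analyticPolys 1) _)

theorem mem_hardy_of_mulOp_pC_mem {c : ℝ} (hc : 0 < c) {f : L2Torus}
    (h : mulOp (pC c) f ∈ hardy) : f ∈ hardy := by
  -- For this κ, κ²|p|² ≤ κ Re p, so |1 - κp|² ≤ 1 - κ Re p and p can be cancelled as a multiple of
  -- 1 - t.
  set κ : ℝ := 1 / (2 * (1 + c)) with hκ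
  have hκ0 : 0 < κ := by positivity
  have key : ∀ x, ‖(1 - (κ : ℂ) • pC c) x‖ ^ 2 ≤ 1 - κ * (pC c x).re := by
    intro x
    have h1 := norm_pC_sq_le hc x
    have h2 : ‖(1 - (κ : ℂ) • pC c) x‖ ^ 2 =
        1 - 2 * κ * (pC c x).re + κ ^ 2 * ‖pC c x‖ ^ 2 := by
      rw [Complex.sq_norm, Complex.sq_norm, Complex.normSq_apply, Complex.normSq_apply]
      simp
      ring
    have h3 : κ ^ 2 * ‖pC c x‖ ^ 2 ≤ κ ^ 2 * (2 * (1 + c) * (pC c x).re) := by gcongr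
    have h4 : κ ^ 2 * (2 * (1 + c) * (pC c x).re) = κ * (pC c x).re := by
      rw [hκ]; field_simp
    linarith
  refine mem_of_sub_mulOp_mem isClosed_hardy (t := 1 - (κ : ℂ) • pC c) ?_ ?_ ?_ ?_
  · intro x
    have h1 := key x
    have h2 : 0 ≤ (pC c x).re := by
      have := two_mul_re_pC c x
      have h3 : 0 ≤ ‖xC x‖ ^ 2 + c * ‖yC x‖ ^ 2 := by positivity
      linarith
    nlinarith [mul_nonneg hκ0.le h2, norm_nonneg ((1 - (κ : ℂ) • pC c) x)]
  · filter_upwards [ae_re_pC_pos hc] with x hx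
    have h1 := key x
    nlinarith [mul_pos hκ0 hx, norm_nonneg ((1 - (κ : ℂ) • pC c) x)]
  · intro f hf
    exact mulOp_mem_hardy (sub_mem (one_mem _) (Subalgebra.smul_mem _ (pC_mem_analyticPolys c) _)) hf
  · rw [mulOp_sub, mulOp_one, sub_sub_cancel, mulOp_smul]
    exact hardy.smul_mem _ h

/-- The multiplier 1 - x/2 = (1 + z₁)/2 is contractive, with modulus 1 only at z₁ = 1. -/
theorem mem_of_mulOp_xC_mem {M : Submodule ℂ L2Torus} (hM : IsClosed (M : Set L2Torus))
    (hinv : ∀ f ∈ M, shift 0 f ∈ M) {f : L2Torus} (h : mulOp xC f ∈ M) : f ∈ M := by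
  have key : ∀ x, ‖(1 - (1 / 2 : ℂ) • xC) x‖ ^ 2 = (1 + (coord 0 x).re) / 2 := by
    intro x
    rw [Complex.sq_norm, Complex.normSq_apply]
    simp [xC_apply]
    linear_combination (1 / 4) * coord_re_im 0 x
  have hle : ∀ x, (coord 0 x).re ≤ 1 := fun x =>
    (Complex.re_le_norm _).trans (norm_coord 0 x).le
  refine mem_of_sub_mulOp_mem hM (t := 1 - (1 / 2 : ℂ) • xC) ?_ ?_ ?_ ?_
  · intro x
    nlinarith [key x, hle x]
  · filter_upwards [ae_coord_zero_ne_one] with x hx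
    have h1 : (coord 0 x).re < 1 := by
      refine lt_of_le_of_ne (hle x) fun h => hx ?_
      have h2 := coord_re_im 0 x
      rw [h] at h2
      have h3 : (coord 0 x).im = 0 := by nlinarith
      exact Complex.ext h h3
    nlinarith [key x]
  · intro f hf
    rw [xC, mulOp_sub, mulOp_one, mulOp_smul, mulOp_sub, mulOp_one]
    exact M.sub_mem hf (M.smul_mem _ (M.sub_mem hf (hinv f hf)))
  · rw [mulOp_sub, mulOp_one, sub_sub_cancel, mulOp_smul]
    exact M.smul_mem _ h

/-! ### Bounded quotients -/

theorem exists_Lp_eq_of_bound {F : Torus → ℂ} (hF : Measurable F) {C : ℝ}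
    (hC : ∀ x, ‖F x‖ ≤ C) : ∃ f : L2Torus, f =ᵐ[torusMeasure] F :=
  ⟨(MemLp.of_bound hF.aestronglyMeasurable C (Eventually.of_forall hC)).toLp F, MemLp.coeFn_toLp _⟩

theorem exists_Lp_eq_mul {F : Torus → ℂ} (hF : Measurable F) (hC : ∀ x, ‖F x‖ ≤ 1)
    (g : L2Torus) : ∃ f : L2Torus, f =ᵐ[torusMeasure] fun x => F x * g x := by
  have h : MemLp (fun x => F x * g x) 2 torusMeasure := by
    refine MemLp.of_le (Lp.memLp g)
      (hF.aestronglyMeasurable.mul (Lp.aestronglyMeasurable g)) (Eventually.of_forall fun x => ?_)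
    rw [norm_mul]
    exact mul_le_of_le_one_left (norm_nonneg _) (hC x)
  exact ⟨h.toLp _, MemLp.coeFn_toLp _⟩

theorem norm_yC_sq_div_pC_le {c : ℝ} (hc : 0 < c) (x : Torus) :
    ‖yC x ^ 2 / pC c x‖ ≤ 2 / c := by
  rw [norm_div, norm_pow]
  have h := c_mul_norm_yC_sq_le (c := c) x
  refine div_le_of_le_mul₀ (norm_nonneg _) (by positivity) ?_
  rw [div_mul_eq_mul_div, le_div_iff₀ hc]
  linarith

theorem mulOp_constOne_mem_hardy {φ : C(Torus, ℂ)} (hφ : φ ∈ analyticPolys) :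
    mulOp φ constOne ∈ hardy :=
  mulOp_mem_hardy hφ (monomial_mem_hardy 0 0)

theorem exists_hardy_eq_sq_div {c : ℝ} (hc : 0 < c) :
    ∃ b ∈ hardy, b =ᵐ[torusMeasure] fun x => yC x ^ 2 / pC c x := by
  obtain ⟨b, hb⟩ := exists_Lp_eq_of_bound (F := fun x => yC x ^ 2 / pC c x)
    ((yC.continuous.measurable.pow_const 2).div (pC c).continuous.measurable)
    (norm_yC_sq_div_pC_le hc)
  refine ⟨b, mem_hardy_of_mulOp_pC_mem hc ?_, hb⟩
  have : mulOp (pC c) b = mulOp (yC ^ 2) constOne := by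
    refine Lp.ext ?_
    filter_upwards [mulOp_coeFn (pC c) b, mulOp_constOne_coeFn (yC ^ 2), hb, ae_pC_ne_zero hc]
      with x h1 h2 h3 h4
    rw [h1, h2, h3, ContinuousMap.pow_apply]
    field_simp
  rw [this]
  exact mulOp_constOne_mem_hardy (pow_mem yC_mem_analyticPolys 2)

theorem exists_hardy_eq_pow_four_div {c : ℝ} (hc : 0 < c) :
    ∃ e ∈ hardy, e =ᵐ[torusMeasure] fun x => yC x ^ 4 / pC c x ^ 2 := by
  obtain ⟨b, hb, hb'⟩ := exists_hardy_eq_sq_div hc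
  obtain ⟨e, he⟩ := exists_Lp_eq_of_bound (F := fun x => yC x ^ 4 / pC c x ^ 2) (C := (2 / c) ^ 2)
    ((yC.continuous.measurable.pow_const 4).div ((pC c).continuous.measurable.pow_const 2))
    (by
      intro x
      have : yC x ^ 4 / pC c x ^ 2 = (yC x ^ 2 / pC c x) ^ 2 := by rw [div_pow]; ring
      rw [this, norm_pow]
      exact pow_le_pow_left₀ (norm_nonneg _) (norm_yC_sq_div_pC_le hc x) 2)
  refine ⟨e, mem_hardy_of_mulOp_pC_mem hc ?_, he⟩
  have : mulOp (pC c) e = mulOp (yC ^ 2) b := by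
    refine Lp.ext ?_
    filter_upwards [mulOp_coeFn (pC c) e, mulOp_coeFn (yC ^ 2) b, he, hb', ae_pC_ne_zero hc]
      with x h1 h2 h3 h4 h5
    rw [h1, h2, h3, h4, ContinuousMap.pow_apply]
    field_simp
  rw [this]
  exact mulOp_mem_hardy (pow_mem yC_mem_analyticPolys 2) hb

/-! ### The inner function `Θ` on the torus -/

theorem bigTheta_eq (c : ℝ) (x : Torus) :
    bigTheta (1 + c) c x = (coord 0 x * coord 1 x * conj (pC c x) / pC c x) ^ 2 := by
  rw [bigTheta, theta]
  have h1 : poly (1 + c) c (coord 0 x) (coord 1 x) = pC c x := by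
    rw [poly, biaffine, pC_apply]; push_cast; ring
  have h2 : polyReflection (1 + c) c (coord 0 x) (coord 1 x) =
      coord 0 x * coord 1 x * conj (pC c x) := by
    rw [polyReflection, biaffineReflection, pC_apply]
    simp only [map_add, map_sub, map_mul, map_one, Complex.conj_ofReal, map_neg, map_zero]
    push_cast
    linear_combination coord 1 x * coord_mul_conj 0 x - c * coord 0 x * coord_mul_conj 1 x
  rw [h1, h2]

theorem measurable_bigTheta (c : ℝ) : Measurable (bigTheta (1 + c) c) := by
  have : bigTheta (1 + c) c =
      fun x => (coord 0 x * coord 1 x * conj (pC c x) / pC c x) ^ 2 := funext (bigTheta_eq c)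
  rw [this]
  exact ((((coord 0).continuous.mul (coord 1).continuous).mul
    (Complex.continuous_conj.comp (pC c).continuous)).measurable.div
      (pC c).continuous.measurable).pow_const 2

theorem norm_bigTheta_le (c : ℝ) (x : Torus) : ‖bigTheta (1 + c) c x‖ ≤ 1 := by
  rw [bigTheta_eq, norm_pow, norm_div, norm_mul, norm_mul, norm_coord, norm_coord, RCLike.norm_conj,
    one_mul, one_mul]
  exact pow_le_one₀ (by positivity) (div_self_le_one _)

theorem exists_Lp_eq_bigTheta_mul (c : ℝ) (g : L2Torus) :
    ∃ f : L2Torus, f =ᵐ[torusMeasure] fun x => bigTheta (1 + c) c x * g x :=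
  exists_Lp_eq_mul (measurable_bigTheta c) (norm_bigTheta_le c) g

theorem exists_Lp_eq_conj_bigTheta_mul (c : ℝ) (g : L2Torus) :
    ∃ f : L2Torus, f =ᵐ[torusMeasure] fun x => conj (bigTheta (1 + c) c x) * g x :=
  exists_Lp_eq_mul (Complex.continuous_conj.measurable.comp (measurable_bigTheta c))
    (fun x => by rw [Function.comp_apply, RCLike.norm_conj]; exact norm_bigTheta_le c x) g

theorem shift_pow_mem {S : Submodule ℂ L2Torus} {j : Fin 2} (h : ∀ f ∈ S, shift j f ∈ S) (n : ℕ)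
    {f : L2Torus} (hf : f ∈ S) : mulOp (coord j ^ n) f ∈ S := by
  induction n with
  | zero => rwa [pow_zero, mulOp_one]
  | succ n ih =>
    rw [pow_succ', mulOp_mul]
    exact h _ ih

/-- By invariance every power of the other coordinate times g stays in K_Θ, hence is orthogonal to Θ
times any monomial. Moving Θ across the inner product turns this into vanishing Fourier coefficients
of Θ̄g at all frequencies n ≥ 0 in z_j. -/
theorem conj_bigTheta_mul_mem_negativeFreq {c : ℝ} {S : Submodule ℂ L2Torus} {j : Fin 2}
    (hS : S ≤ modelSpace (bigTheta (1 + c) c)) (hinv : ∀ f ∈ S, shift (1 - j) f ∈ S)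
    {g G : L2Torus} (hg : g ∈ S)
    (hG : G =ᵐ[torusMeasure] fun x => conj (bigTheta (1 + c) c x) * g x) :
    G ∈ negativeFreq j := by
  intro i k n
  set M := mulOp (coord (1 - j) ^ k * coord j ^ n) constOne with hM
  have hMh : M ∈ hardy := mulOp_constOne_mem_hardy
    (mul_mem (pow_mem (coord_mem_analyticPolys _) k) (pow_mem (coord_mem_analyticPolys _) n))
  obtain ⟨T, hT⟩ := exists_Lp_eq_bigTheta_mul c M
  have h := (hS (shift_pow_mem hinv i hg)).2 T ⟨M, hMh, hT⟩
  rw [← h, mean_eq_integral, inner_eq_integral]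
  refine integral_congr_ae ?_
  filter_upwards [mulOp_coeFn (coord (1 - j) ^ i * star (coord (1 - j)) ^ k * star (coord j) ^ n) G,
    hG, hT, mulOp_constOne_coeFn (coord (1 - j) ^ k * coord j ^ n),
    mulOp_coeFn (coord (1 - j) ^ i) g] with x h1 h2 h3 h4 h5
  rw [h1, h2, h3, h4, h5]
  simp only [ContinuousMap.mul_apply, ContinuousMap.pow_apply, ContinuousMap.star_apply,
    map_mul, map_pow, starRingEnd_apply]
  ring

/-! ### Explicit elements of the `M_{z₂}`-invariant summand -/

theorem coord_zero_mem_rightCoanalytic_one : coord 0 ∈ rightCoanalytic 1 :=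
  Algebra.subset_adjoin (by simp)

theorem star_coord_mem_rightCoanalytic_one (j : Fin 2) : star (coord j) ∈ rightCoanalytic 1 :=
  Algebra.subset_adjoin (by fin_cases j <;> simp)

theorem coord_one_mem_rightCoanalytic_zero : coord 1 ∈ rightCoanalytic 0 :=
  Algebra.subset_adjoin (by simp)

theorem star_coord_mem_rightCoanalytic_zero (j : Fin 2) : star (coord j) ∈ rightCoanalytic 0 :=
  Algebra.subset_adjoin (by fin_cases j <;> simp)

theorem star_yC : star yC = 1 + star (coord 1) := by rw [yC, star_add, star_one]

theorem star_pC (c : ℝ) :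
    star (pC c) = (1 + c : ℂ) • 1 - star (coord 0) + (c : ℂ) • star (coord 1) := by
  ext x; simp [pC]

theorem conj_pC (c : ℝ) (x : Torus) :
    conj (pC c x) = 1 + c - conj (coord 0 x) + c * conj (coord 1 x) := by
  rw [pC_apply]; simp

theorem conj_yC (x : Torus) : conj (yC x) = 1 + conj (coord 1 x) := by
  rw [yC_apply]; simp

/-- The term z̄₂p has no positive z₂-frequency and z₁p̄ no negative z₁-frequency; orthogonality to
S₁ rests on this splitting. -/
theorem one_add_mul_xC_mul_conj_yC (c : ℝ) (x : Torus) :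
    (1 + c) * (xC x * conj (yC x)) =
      conj (coord 1 x) * pC c x - coord 0 x * conj (pC c x) := by
  rw [conj_pC, conj_yC, pC_apply, xC_apply]
  linear_combination -c * coord_mul_conj 1 x - coord_mul_conj 0 x

theorem conj_bigTheta (c : ℝ) (x : Torus) :
    conj (bigTheta (1 + c) c x) =
      (conj (coord 0 x) * conj (coord 1 x) * pC c x * (conj (pC c x))⁻¹) ^ 2 := by
  rw [bigTheta_eq, map_pow, map_div₀, map_mul, map_mul, Complex.conj_conj, div_eq_mul_inv]

theorem star_yC_mem_leftAnalytic : star yC ∈ leftAnalytic := by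
  rw [star_yC]; exact add_mem (one_mem _) star_coord_one_mem_leftAnalytic

theorem pC_mem_leftAnalytic (c : ℝ) : pC c ∈ leftAnalytic :=
  add_mem (sub_mem (Subalgebra.smul_mem _ (one_mem _) _) coord_zero_mem_leftAnalytic)
    (Subalgebra.smul_mem _ coord_one_mem_leftAnalytic _)

theorem star_pC_mem_rightCoanalytic_one (c : ℝ) : star (pC c) ∈ rightCoanalytic 1 := by
  rw [star_pC]
  exact add_mem (sub_mem (Subalgebra.smul_mem _ (one_mem _) _)
    (star_coord_mem_rightCoanalytic_one 0))
    (Subalgebra.smul_mem _ (star_coord_mem_rightCoanalytic_one 1) _)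

theorem star_pC_mem_rightCoanalytic_zero (c : ℝ) : star (pC c) ∈ rightCoanalytic 0 := by
  rw [star_pC]
  exact add_mem (sub_mem (Subalgebra.smul_mem _ (one_mem _) _)
    (star_coord_mem_rightCoanalytic_zero 0))
    (Subalgebra.smul_mem _ (star_coord_mem_rightCoanalytic_zero 1) _)

theorem star_coord_one_mul_pC_mem (c : ℝ) : star (coord 1) * pC c ∈ rightCoanalytic 1 := by
  have : star (coord 1) * pC c =
      (1 + c : ℂ) • star (coord 1) - star (coord 1) * coord 0 + (c : ℂ) • 1 := by
    rw [← star_coord_mul_coord 1, pC]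
    simp only [mul_add, mul_sub, mul_smul_comm, mul_one]
  rw [this]
  exact add_mem (sub_mem (Subalgebra.smul_mem _ (star_coord_mem_rightCoanalytic_one 1) _)
    (mul_mem (star_coord_mem_rightCoanalytic_one 1) coord_zero_mem_rightCoanalytic_one))
    (Subalgebra.smul_mem _ (one_mem _) _)

theorem coord_zero_mul_star_pC_mem (c : ℝ) : coord 0 * star (pC c) ∈ leftAnalytic := by
  have : coord 0 * star (pC c) =
      (1 + c : ℂ) • coord 0 - 1 + (c : ℂ) • (coord 0 * star (coord 1)) := by
    rw [← star_coord_mul_coord 0, star_pC]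
    simp only [mul_add, mul_sub, mul_smul_comm, mul_one]
    rw [mul_comm (coord 0) (star (coord 0))]
  rw [this]
  exact add_mem (sub_mem (Subalgebra.smul_mem _ coord_zero_mem_leftAnalytic _) (one_mem _))
    (Subalgebra.smul_mem _ (mul_mem coord_zero_mem_leftAnalytic star_coord_one_mem_leftAnalytic) _)

/-- Here `s` is 1 + c, `i` is 1/p̄, and primes and `w`s are conjugates. With A = z̄₂p and B = z₁p̄,
expand (A - B)³/p̄²: the terms A³ and -3A²B carry Θ̄ = (z̄₁z̄₂p/p̄)², while 3AB² and -B³ lose their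
denominator. -/
theorem cube_identity {s ξ y' z₁ w₁ w₂ p p' i wk γ : ℂ}
    (hx : s * (ξ * y') = w₂ * p - z₁ * p') (h0 : z₁ * w₁ = 1) (hi : p' * i = 1) :
    s ^ 3 * ((wk * (y' ^ 4 * i ^ 2)) * (ξ ^ 3 * γ)) =
      wk * y' * (z₁ ^ 2 * (w₂ * p) - 3 * (z₁ ^ 3 * p')) * ((w₁ * w₂ * p * i) ^ 2 * γ) +
      wk * z₁ * y' * (3 * (w₂ * p) - z₁ * p') * z₁ * γ := by
  have hx3 : s ^ 3 * (ξ * y') ^ 3 = (w₂ * p - z₁ * p') ^ 3 := by rw [← mul_pow, hx]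
  linear_combination (wk * y' * i ^ 2 * γ) * hx3 +
    (wk * y' * γ) * ((-(w₂ * p) ^ 3 * i ^ 2 + 3 * (w₂ * p) ^ 2 * (z₁ * p') * i ^ 2) *
      (z₁ * w₁ + 1)) * h0 +
    (wk * y' * γ) * ((3 * (w₂ * p) * z₁ ^ 2 - z₁ ^ 3 * p') * (p' * i + 1)) * hi

/-- The half of `cube_identity` with Θ̄g has only negative z₂-frequencies, and the half with g only
positive z₁-frequencies. The condition k + l = 1 ensures that z̄₁ᵏz₁ = z₁ˡ is still analytic. -/
theorem inner_xC_cube_eq_zero {c : ℝ} (hc : 0 < c) {S : Submodule ℂ L2Torus}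
    (hS : S ≤ modelSpace (bigTheta (1 + c) c)) (hinv : ∀ f ∈ S, shift 0 f ∈ S)
    {e : L2Torus} (he : e =ᵐ[torusMeasure] fun x => yC x ^ 4 / pC c x ^ 2)
    {k l : ℕ} (hkl : k + l = 1) {g : L2Torus} (hg : g ∈ S) :
    inner ℂ (mulOp (coord 0 ^ k) e) (mulOp (xC ^ 3) g) = 0 := by
  obtain ⟨G, hG⟩ := exists_Lp_eq_conj_bigTheta_mul c g
  have hGn : G ∈ negativeFreq 1 :=
    conj_bigTheta_mul_mem_negativeFreq hS (by rwa [sub_self]) hg hG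
  have hgh : g ∈ hardy := (hS hg).1
  set φ : C(Torus, ℂ) := star (coord 0) ^ k * star yC *
    (coord 0 ^ 2 * (star (coord 1) * pC c) - (3 : ℂ) • (coord 0 ^ 3 * star (pC c))) with hφ
  set ψ : C(Torus, ℂ) := coord 0 ^ l * star yC *
    ((3 : ℂ) • (star (coord 1) * pC c) - coord 0 * star (pC c)) with hψ
  have h1 : mean (mulOp φ G) = 0 := by
    refine mean_eq_zero_of_mem_negativeFreq (j := 1) (mulOp_mem_negativeFreq ?_ hGn)
    have hy : star yC ∈ rightCoanalytic 1 := by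
      rw [star_yC]; exact add_mem (one_mem _) (star_coord_mem_rightCoanalytic_one 1)
    exact mul_mem (mul_mem (pow_mem (star_coord_mem_rightCoanalytic_one 0) _) hy)
      (sub_mem (mul_mem (pow_mem coord_zero_mem_rightCoanalytic_one _)
        (star_coord_one_mul_pC_mem c)) (Subalgebra.smul_mem _
          (mul_mem (pow_mem coord_zero_mem_rightCoanalytic_one _)
            (star_pC_mem_rightCoanalytic_one c)) _))
  have h2 : mean (mulOp (ψ * coord 0) g) = 0 := by
    refine mean_mulOp_mul_coord_zero ?_ hgh
    exact mul_mem (mul_mem (pow_mem coord_zero_mem_leftAnalytic _) star_yC_mem_leftAnalytic)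
      (sub_mem (Subalgebra.smul_mem _ (mul_mem star_coord_one_mem_leftAnalytic
        (pC_mem_leftAnalytic c)) _) (coord_zero_mul_star_pC_mem c))
  have h3 : (1 + c : ℂ) ^ 3 * inner ℂ (mulOp (coord 0 ^ k) e) (mulOp (xC ^ 3) g) =
      mean (mulOp φ G + mulOp (ψ * coord 0) g) := by
    rw [mean_eq_integral, inner_eq_integral, ← integral_const_mul]
    refine integral_congr_ae ?_
    filter_upwards [mulOp_coeFn φ G, mulOp_coeFn (ψ * coord 0) g, hG, he,
      Lp.coeFn_add (mulOp φ G) (mulOp (ψ * coord 0) g), mulOp_coeFn (coord 0 ^ k) e,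
      mulOp_coeFn (xC ^ 3) g, ae_pC_ne_zero hc] with x a1 a2 a3 a4 a5 a6 a7 a8
    rw [a5, Pi.add_apply, a1, a2, a3, a6, a4, a7, conj_bigTheta, hφ, hψ]
    simp only [ContinuousMap.mul_apply, ContinuousMap.pow_apply, ContinuousMap.star_apply,
      ContinuousMap.sub_apply, ContinuousMap.smul_apply, smul_eq_mul, map_mul, map_pow,
      map_div₀, ← starRingEnd_apply]
    have hi : conj (pC c x) * (conj (pC c x))⁻¹ = 1 :=
      mul_inv_cancel₀ ((map_ne_zero _).2 a8)
    have hx := one_add_mul_xC_mul_conj_yC c x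
    have h0 := coord_mul_conj 0 x
    have hk : conj (coord 0 x) ^ k * coord 0 x = coord 0 x ^ l := by
      have : k = 0 ∧ l = 1 ∨ k = 1 ∧ l = 0 := by lia
      rcases this with ⟨rfl, rfl⟩ | ⟨rfl, rfl⟩
      · simp
      · rw [pow_one, pow_zero, mul_comm, h0]
    have key := cube_identity (wk := conj (coord 0 x) ^ k) (γ := g x) hx h0 hi
    rw [← hk]
    linear_combination key
  rw [map_add, h1, h2, add_zero] at h3
  have hc' : (1 + c : ℂ) ^ 3 ≠ 0 := by
    apply pow_ne_zero
    exact_mod_cast (by positivity : (1 + c : ℝ) ≠ 0)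
  exact (mul_eq_zero.1 h3).resolve_left hc'

theorem inner_eq_zero_of_shift_invariant {c : ℝ} (hc : 0 < c) {S : Submodule ℂ L2Torus}
    (hS : S ≤ modelSpace (bigTheta (1 + c) c)) (hinv : ∀ f ∈ S, shift 0 f ∈ S)
    {e : L2Torus} (he : e =ᵐ[torusMeasure] fun x => yC x ^ 4 / pC c x ^ 2)
    {k l : ℕ} (hkl : k + l = 1) {g : L2Torus} (hg : g ∈ S) :
    inner ℂ (mulOp (coord 0 ^ k) e) g = 0 := by
  -- Asking for orthogonality of the whole orbit z₁ⁿf makes M closed and shift-invariant, so x can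
  -- be cancelled three times.
  set M : Submodule ℂ L2Torus :=
    ⨅ n : ℕ, (innerSL ℂ (mulOp (coord 0 ^ k) e) ∘L mulOp (coord 0 ^ n)).ker with hM
  have mem : ∀ f, f ∈ M ↔ ∀ n : ℕ,
      inner ℂ (mulOp (coord 0 ^ k) e) (mulOp (coord 0 ^ n) f) = 0 := by
    intro f
    rw [hM, Submodule.mem_iInf]
    rfl
  have hMc : IsClosed (M : Set L2Torus) := by
    rw [hM, Submodule.coe_iInf]
    exact isClosed_iInter fun n => ContinuousLinearMap.isClosed_ker _
  have hMi : ∀ f ∈ M, shift 0 f ∈ M := by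
    intro f hf
    rw [mem] at hf ⊢
    intro n
    rw [shift, ← mulOp_mul, ← pow_succ]
    exact hf (n + 1)
  have h3 : mulOp (xC ^ 3) g ∈ M := by
    rw [mem]
    intro n
    rw [mulOp_comm]
    exact inner_xC_cube_eq_zero hc hS hinv he hkl (shift_pow_mem hinv n hg)
  have h4 : g ∈ M := by
    have e3 : mulOp (xC ^ 3) g = mulOp xC (mulOp xC (mulOp xC g)) := by
      rw [← mulOp_mul, ← mulOp_mul]; congr 2; ring
    rw [e3] at h3
    exact mem_of_mulOp_xC_mem hMc hMi (mem_of_mulOp_xC_mem hMc hMi (mem_of_mulOp_xC_mem hMc hMi h3))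
  have := (mem g).1 h4 0
  rwa [pow_zero, mulOp_one] at this

/-- On the torus ȳ = z̄₂y, so Θē = z₁²z̄₂²e. After multiplication by z̄₁ᵏ with k ≤ 1 the
z₁-frequencies are still strictly positive. -/
theorem coord_pow_mulOp_mem_modelSpace {c : ℝ} (hc : 0 < c) {e : L2Torus} (heh : e ∈ hardy)
    (he : e =ᵐ[torusMeasure] fun x => yC x ^ 4 / pC c x ^ 2) {k l : ℕ} (hkl : k + l = 1) :
    mulOp (coord 0 ^ k) e ∈ modelSpace (bigTheta (1 + c) c) := by
  refine ⟨mulOp_mem_hardy (pow_mem (coord_mem_analyticPolys 0) k) heh, ?_⟩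
  rintro T ⟨h, hh, hT⟩
  obtain ⟨E, hE⟩ := exists_Lp_eq_conj_bigTheta_mul c (mulOp (coord 0 ^ k) e)
  have h1 : inner ℂ T (mulOp (coord 0 ^ k) e) = inner ℂ h E := by
    rw [inner_eq_integral, inner_eq_integral]
    refine integral_congr_ae ?_
    filter_upwards [hT, hE] with x h1 h2
    rw [h1, h2, map_mul]; ring
  have h2 : hardy ≤ (innerSL ℂ E).ker := by
    refine hardy_le_of_monomial_mem (ContinuousLinearMap.isClosed_ker _) fun m n => ?_
    change inner ℂ E (monomial m n) = 0
    have h3 : mean (mulOp (coord 0 ^ l * star (coord 1) ^ 2 * coord 0 ^ m * coord 1 ^ n *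
        coord 0) e) = 0 := by
      refine mean_mulOp_mul_coord_zero ?_ heh
      exact mul_mem (mul_mem (mul_mem (pow_mem coord_zero_mem_leftAnalytic _)
        (pow_mem star_coord_one_mem_leftAnalytic _)) (pow_mem coord_zero_mem_leftAnalytic _))
        (pow_mem coord_one_mem_leftAnalytic _)
    rw [← h3, mean_eq_integral, inner_eq_integral, monomial_eq_mulOp]
    refine integral_congr_ae ?_
    filter_upwards [hE, he, mulOp_coeFn (coord 0 ^ k) e,
      mulOp_constOne_coeFn (coord 0 ^ m * coord 1 ^ n), ae_pC_ne_zero hc,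
      mulOp_coeFn (coord 0 ^ l * star (coord 1) ^ 2 * coord 0 ^ m * coord 1 ^ n * coord 0) e]
      with x a1 a2 a3 a4 a5 a6
    rw [a1, a3, a4, a6, a2, map_mul, Complex.conj_conj, bigTheta_eq]
    simp only [ContinuousMap.mul_apply, ContinuousMap.pow_apply, ContinuousMap.star_apply,
      map_mul, map_pow, map_div₀, ← starRingEnd_apply]
    have hi : conj (pC c x) * (conj (pC c x))⁻¹ = 1 :=
      mul_inv_cancel₀ ((map_ne_zero _).2 a5)
    have h0 := coord_mul_conj 0 x
    have h1 := coord_mul_conj 1 x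
    have hk : conj (coord 0 x) ^ k * coord 0 x = coord 0 x ^ l := by
      have : k = 0 ∧ l = 1 ∨ k = 1 ∧ l = 0 := by lia
      rcases this with ⟨rfl, rfl⟩ | ⟨rfl, rfl⟩
      · simp
      · rw [pow_one, pow_zero, mul_comm, h0]
    have hy : conj (yC x) = conj (coord 1 x) * yC x := by
      rw [conj_yC, yC_apply]; linear_combination -h1
    rw [hy, div_eq_mul_inv, div_eq_mul_inv, div_eq_mul_inv, ← inv_pow, ← inv_pow, ← hk]
    generalize conj (coord 0 x) ^ k = wk at *
    generalize (conj (pC c x))⁻¹ = i at *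
    generalize (pC c x)⁻¹ = j at *
    generalize conj (pC c x) = p' at *
    generalize conj (coord 1 x) = w2 at *
    generalize yC x = y at *
    generalize coord 0 x ^ m = zm at *
    generalize coord 1 x ^ n = zn at *
    generalize coord 0 x = z1 at *
    generalize coord 1 x = z2 at *
    linear_combination (wk * y ^ 4 * j ^ 2 * z1 ^ 2 * zm * zn) * (w2 ^ 2 * (z2 * w2 + 1) *
      (p' * i) ^ 2 * h1 + w2 ^ 2 * (p' * i + 1) * hi)
  rw [h1]
  have := h2 hh
  rw [← inner_conj_symm]
  change conj (innerSL ℂ E h) = 0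
  rw [LinearMap.mem_ker] at this
  change innerSL ℂ E h = 0 at this
  rw [this, map_zero]

theorem IsShiftDecomposition.le_modelSpace₁ {Θ : Torus → ℂ} {S₁ S₂ : Submodule ℂ L2Torus}
    (hS : IsShiftDecomposition Θ S₁ S₂) : S₁ ≤ modelSpace Θ := hS.sup_eq ▸ le_sup_left

theorem IsShiftDecomposition.le_modelSpace₂ {Θ : Torus → ℂ} {S₁ S₂ : Submodule ℂ L2Torus}
    (hS : IsShiftDecomposition Θ S₁ S₂) : S₂ ≤ modelSpace Θ := hS.sup_eq ▸ le_sup_right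

theorem IsShiftDecomposition.mem_of_inner_eq_zero {Θ : Torus → ℂ} {S₁ S₂ : Submodule ℂ L2Torus}
    (hS : IsShiftDecomposition Θ S₁ S₂) {f : L2Torus} (hf : f ∈ modelSpace Θ)
    (h : ∀ g ∈ S₁, inner ℂ f g = 0) : f ∈ S₂ := by
  rw [← hS.sup_eq] at hf
  obtain ⟨s, hs, t, ht, rfl⟩ := Submodule.mem_sup.1 hf
  have h1 := h s hs
  rw [inner_add_left, (Submodule.isOrtho_iff_inner_eq.1 hS.orthogonal.symm) t ht s hs, add_zero,
    inner_self_eq_zero] at h1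
  rwa [h1, zero_add]

theorem mem_of_isShiftDecomposition {c : ℝ} (hc : 0 < c) {S₁ S₂ : Submodule ℂ L2Torus}
    (hS : IsShiftDecomposition (bigTheta (1 + c) c) S₁ S₂) {e : L2Torus} (heh : e ∈ hardy)
    (he : e =ᵐ[torusMeasure] fun x => yC x ^ 4 / pC c x ^ 2) :
    e ∈ S₂ ∧ mulOp (coord 0) e ∈ S₂ := by
  have key : ∀ k l : ℕ, k + l = 1 → mulOp (coord 0 ^ k) e ∈ S₂ := fun k l hkl =>
    hS.mem_of_inner_eq_zero (coord_pow_mulOp_mem_modelSpace hc heh he hkl) fun g hg =>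
      inner_eq_zero_of_shift_invariant hc hS.le_modelSpace₁ hS.invariant₁ he hkl hg
  have h0 := key 0 1 rfl
  have h1 := key 1 0 rfl
  rw [pow_zero, mulOp_one] at h0
  rw [pow_one] at h1
  exact ⟨h0, h1⟩

/-! ### The shift has no approximate eigenvalue `-1` on the `M_{z₂}`-invariant summand -/

theorem norm_mulOp_le_mul {φ : C(Torus, ℂ)} {C : ℝ} (hφ : ∀ x, ‖φ x‖ ≤ C) (f : L2Torus) :
    ‖mulOp φ f‖ ≤ C * ‖f‖ := by
  refine Lp.norm_le_mul_norm_of_ae_le_mul ?_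
  filter_upwards [mulOp_coeFn φ f] with x hx
  rw [hx, norm_mul]
  exact mul_le_mul_of_nonneg_right (hφ x) (norm_nonneg _)

theorem inner_shift_shift (j : Fin 2) (f g : L2Torus) :
    inner ℂ (shift j f) (shift j g) = inner ℂ f g := by
  rw [shift, inner_mulOp, ← mulOp_mul, star_coord_mul_coord, mulOp_one]

theorem norm_shift (j : Fin 2) (f : L2Torus) : ‖shift j f‖ = ‖f‖ := by
  have h := inner_shift_shift j f f
  rw [inner_self_eq_norm_sq_to_K, inner_self_eq_norm_sq_to_K] at h
  have h2 : ‖shift j f‖ ^ 2 = ‖f‖ ^ 2 := by exact_mod_cast h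
  exact (sq_eq_sq₀ (norm_nonneg _) (norm_nonneg _)).1 h2

theorem norm_add_shift_sq (j : Fin 2) (f : L2Torus) :
    ‖f + shift j f‖ ^ 2 = 2 * ‖f‖ ^ 2 + 2 * (inner ℂ f (shift j f)).re := by
  rw [norm_add_sq (𝕜 := ℂ), norm_shift]
  simp only [RCLike.re_to_complex]
  ring

/-- N has z₁-degree at most 1, say N = N₀ + N₁ by degree. Then ⟨N, z₁N⟩ = ⟨N₁, z₁N₀⟩ has modulus at
most ‖N₀‖‖N₁‖ ≤ ‖N‖²/2, whence ‖N + z₁N‖² ≥ 2‖N‖² - ‖N‖². -/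
theorem norm_le_norm_add_shift {N : L2Torus} (hN : N ∈ hardy)
    (h : ∀ m n : ℕ, inner ℂ (monomial (m + 2) n) N = 0) : ‖N‖ ≤ ‖N + shift 0 N‖ := by
  -- K stands for z₁H².
  set K : Submodule ℂ L2Torus :=
    (Submodule.span ℂ (Set.range fun k : ℕ × ℕ => monomial (k.1 + 1) k.2)).topologicalClosure
    with hK
  have hKc : IsClosed (K : Set L2Torus) := Submodule.isClosed_topologicalClosure _
  have hmem : ∀ m n, monomial (m + 1) n ∈ K := fun m n =>
    Submodule.le_topologicalClosure _ (Submodule.subset_span ⟨(m, n), rfl⟩)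
  have hshift : ∀ m n, shift 0 (monomial m n) = monomial (m + 1) n := by
    intro m n
    rw [monomial_eq_mulOp, monomial_eq_mulOp, shift, ← mulOp_mul]
    congr 2; ring
  have hKle : ∀ M : Submodule ℂ L2Torus, IsClosed (M : Set L2Torus) →
      (∀ m n, monomial (m + 1) n ∈ M) → K ≤ M := by
    intro M hM hm
    refine Submodule.topologicalClosure_minimal _ ?_ hM
    rw [Submodule.span_le]
    rintro _ ⟨k, rfl⟩
    exact hm _ _
  have hKh : K ≤ hardy := hKle _ isClosed_hardy fun m n => monomial_mem_hardy _ _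
  have hhK : ∀ f ∈ hardy, shift 0 f ∈ K := by
    have : hardy ≤ K.comap (shift 0 : L2Torus →ₗ[ℂ] L2Torus) := by
      refine hardy_le_of_monomial_mem (hKc.preimage (shift 0).continuous) fun m n => ?_
      rw [Submodule.mem_comap]
      change shift 0 (monomial m n) ∈ K
      rw [hshift]
      exact hmem m n
    exact fun f hf => this hf
  have hKN : ∀ f ∈ K, inner ℂ N (shift 0 f) = 0 := by
    have : K ≤ (innerSL ℂ N ∘L shift 0).ker := by
      refine hKle _ (ContinuousLinearMap.isClosed_ker _) fun m n => ?_
      change inner ℂ N (shift 0 (monomial (m + 1) n)) = 0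
      rw [hshift, ← inner_conj_symm, h, map_zero]
    exact fun f hf => this hf
  have : CompleteSpace K := hKc.completeSpace_coe
  set N₁ := K.starProjection N with hN₁
  have hN₁K : N₁ ∈ K := Submodule.starProjection_apply_mem K N
  set N₀ := N - N₁ with hN₀
  have hN₀K : ∀ f ∈ K, inner ℂ N₀ f = 0 := fun f hf =>
    Submodule.starProjection_inner_eq_zero N f hf
  have hN₀h : N₀ ∈ hardy := hardy.sub_mem hN (hKh hN₁K)
  have hsum : N = N₁ + N₀ := by rw [hN₀]; abel
  have hsq : ‖N‖ ^ 2 = ‖N₁‖ ^ 2 + ‖N₀‖ ^ 2 := by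
    have h0 : inner ℂ N₁ N₀ = 0 := by rw [← inner_conj_symm, hN₀K _ hN₁K, map_zero]
    rw [hsum, norm_add_sq (𝕜 := ℂ), h0]; simp
  have hin : inner ℂ N (shift 0 N) = inner ℂ N₁ (shift 0 N₀) := by
    have e1 : inner ℂ N (shift 0 N) = inner ℂ N (shift 0 N₁) + inner ℂ N (shift 0 N₀) := by
      rw [← inner_add_right, ← map_add, ← hsum]
    rw [e1, hKN _ hN₁K, zero_add]
    nth_rw 1 [hsum]
    rw [inner_add_left, hN₀K _ (hhK _ hN₀h), add_zero]
  have hle : ‖inner ℂ N (shift 0 N)‖ ≤ ‖N₁‖ * ‖N₀‖ := by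
    rw [hin]
    exact (norm_inner_le_norm _ _).trans (by rw [norm_shift])
  have hre := (abs_le.1 ((Complex.abs_re_le_norm _).trans hle)).1
  have hs := norm_add_shift_sq 0 N
  refine le_of_sq_le_sq ?_ (norm_nonneg _)
  nlinarith [sq_nonneg (‖N₁‖ - ‖N₀‖)]

theorem norm_pC_le {c : ℝ} (hc : 0 < c) (x : Torus) : ‖pC c x‖ ≤ 2 * (1 + c) := by
  have h1 := norm_pC_sq_le hc x
  have h2 := Complex.re_le_norm (pC c x)
  have h3 : 2 * (1 + c) * (pC c x).re ≤ 2 * (1 + c) * ‖pC c x‖ := by gcongr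
  by_contra! h
  nlinarith [norm_nonneg (pC c x)]

/-- Θ̄h has only negative z₁-frequencies, so N = p²h = (z₁z₂p̄)²Θ̄h has z₁-degree at most 1 and
`norm_le_norm_add_shift` applies to N. The bound passes back to h because p and 1 + z₁ are never
small together. -/
theorem exists_norm_le_mul_norm_add_shift {c : ℝ} (hc : 0 < c) {S : Submodule ℂ L2Torus}
    (hS : S ≤ modelSpace (bigTheta (1 + c) c)) (hinv : ∀ f ∈ S, shift 1 f ∈ S) :
    ∃ C : ℝ, 0 < C ∧ ∀ h ∈ S, ‖h‖ ^ 2 ≤ C * ‖h + shift 0 h‖ ^ 2 := by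
  refine ⟨1 + 16 * ((2 * (1 + c)) ^ 2) ^ 2, by positivity, fun h hh => ?_⟩
  have hhh : h ∈ hardy := (hS hh).1
  obtain ⟨H, hH⟩ := exists_Lp_eq_conj_bigTheta_mul c h
  have hHn : H ∈ negativeFreq 0 :=
    conj_bigTheta_mul_mem_negativeFreq hS (by rwa [sub_zero]) hh hH
  set N := mulOp (pC c ^ 2) h with hN
  have hN2 : N = mulOp ((coord 0 * coord 1 * star (pC c)) ^ 2) H := by
    refine Lp.ext ?_
    filter_upwards [mulOp_coeFn (pC c ^ 2) h,
      mulOp_coeFn ((coord 0 * coord 1 * star (pC c)) ^ 2) H, hH, ae_pC_ne_zero hc]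
      with x a1 a2 a3 a4
    rw [hN, a1, a2, a3, conj_bigTheta]
    simp only [ContinuousMap.mul_apply, ContinuousMap.pow_apply, ContinuousMap.star_apply,
      ← starRingEnd_apply]
    have hi : conj (pC c x) * (conj (pC c x))⁻¹ = 1 :=
      mul_inv_cancel₀ ((map_ne_zero _).2 a4)
    have h0 := coord_mul_conj 0 x
    have h1 := coord_mul_conj 1 x
    have : coord 0 x * coord 1 x * conj (pC c x) *
        (conj (coord 0 x) * conj (coord 1 x) * pC c x * (conj (pC c x))⁻¹) = pC c x := by
      linear_combination (coord 1 x * conj (coord 1 x) * pC c x *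
        (conj (pC c x) * (conj (pC c x))⁻¹)) * h0 + (pC c x *
        (conj (pC c x) * (conj (pC c x))⁻¹)) * h1 + pC c x * hi
    rw [← mul_assoc, ← mul_pow, this]
  have hNh : N ∈ hardy := mulOp_mem_hardy (pow_mem (pC_mem_analyticPolys c) 2) hhh
  have hNle : ‖N‖ ≤ ‖N + shift 0 N‖ := by
    refine norm_le_norm_add_shift hNh fun m n => ?_
    rw [monomial_eq_mulOp, inner_mulOp_constOne, hN2, ← mulOp_mul]
    have e : star (coord 0 ^ (m + 2) * coord 1 ^ n) * (coord 0 * coord 1 * star (pC c)) ^ 2 =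
        star (coord 0) ^ m * star (coord 1) ^ n * (coord 1 * star (pC c)) ^ 2 := by
      have h0 := star_coord_mul_coord 0
      rw [star_mul, star_pow, star_pow]
      linear_combination (star (coord 0) ^ m * star (coord 1) ^ n * (coord 1 * star (pC c)) ^ 2 *
        (star (coord 0) * coord 0 + 1)) * h0
    rw [e]
    refine mean_eq_zero_of_mem_negativeFreq (mulOp_mem_negativeFreq (j := 0) ?_ hHn)
    exact mul_mem (mul_mem (pow_mem (star_coord_mem_rightCoanalytic_zero 0) _)
      (pow_mem (star_coord_mem_rightCoanalytic_zero 1) _))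
      (pow_mem (mul_mem coord_one_mem_rightCoanalytic_zero (star_pC_mem_rightCoanalytic_zero c)) _)
  have hNle2 : ‖N‖ ≤ (2 * (1 + c)) ^ 2 * ‖h + shift 0 h‖ := by
    have e : N + shift 0 N = mulOp (pC c ^ 2) (h + shift 0 h) := by
      rw [map_add, hN, shift, mulOp_comm]
    rw [e] at hNle
    refine hNle.trans (norm_mulOp_le_mul (fun x => ?_) _)
    rw [ContinuousMap.pow_apply, norm_pow]
    exact pow_le_pow_left₀ (norm_nonneg _) (norm_pC_le hc x) 2
  have hsplit : ‖h‖ ^ 2 ≤ ‖h + shift 0 h‖ ^ 2 + 16 * ‖N‖ ^ 2 := by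
    rw [norm_sq_eq_integral, norm_sq_eq_integral, norm_sq_eq_integral, ← integral_const_mul,
      ← integral_add (integrable_norm_sq _) ((integrable_norm_sq _).const_mul _)]
    refine integral_mono_ae (integrable_norm_sq _)
      ((integrable_norm_sq _).add ((integrable_norm_sq _).const_mul _)) ?_
    filter_upwards [mulOp_coeFn (pC c ^ 2) h, mulOp_coeFn (coord 0) h,
      Lp.coeFn_add h (shift 0 h)] with x a1 a2 a3
    have a4 : (h + shift 0 h) x = (1 + coord 0 x) * h x := by
      rw [a3, Pi.add_apply, shift, a2]; ring
    -- If |1 + z₁| < 1 then |1 - z₁| ≥ 1, which forces |p| ≥ 1/2; hence the constant 16.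
    have key : 1 ≤ ‖1 + coord 0 x‖ ^ 2 + 16 * (‖pC c x‖ ^ 2) ^ 2 := by
      by_cases h1 : 1 ≤ ‖1 + coord 0 x‖
      · nlinarith [sq_nonneg (‖pC c x‖ ^ 2)]
      · push Not at h1
        have h2 : 1 ≤ ‖xC x‖ := by
          have : (2 : ℂ) = xC x + (1 + coord 0 x) := by rw [xC_apply]; ring
          have h3 : ‖(2 : ℂ)‖ ≤ ‖xC x‖ + ‖1 + coord 0 x‖ := by
            rw [this]; exact norm_add_le _ _
          simp only [Complex.norm_ofNat] at h3
          linarith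
        have h3 := norm_xC_sq_le hc x
        have h4 : 1 / 2 ≤ ‖pC c x‖ := by nlinarith
        have h5 : 1 / 4 ≤ ‖pC c x‖ ^ 2 := by nlinarith
        nlinarith [sq_nonneg ‖1 + coord 0 x‖]
    change ‖h x‖ ^ 2 ≤ ‖(h + shift 0 h) x‖ ^ 2 + 16 * ‖N x‖ ^ 2
    rw [a4, hN, a1, ContinuousMap.pow_apply, norm_mul, norm_mul, norm_pow, mul_pow, mul_pow]
    nlinarith [mul_le_mul_of_nonneg_right key (sq_nonneg ‖h x‖)]
  have hsq : ‖N‖ ^ 2 ≤ ((2 * (1 + c)) ^ 2 * ‖h + shift 0 h‖) ^ 2 :=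
    pow_le_pow_left₀ (norm_nonneg _) hNle2 2
  nlinarith

/-! ### Quadratic forms on explicit elements -/

theorem integral_coord_one (B : C(UnitAddCircle, ℂ)) :
    ∫ x : Torus, lift B x ∂torusMeasure = ∫ t, B t ∂AddCircle.haarAddCircle := by
  have h := measurePreserving_eval (fun _ : Fin 2 =>
    (AddCircle.haarAddCircle : Measure UnitAddCircle)) 1
  have h2 := h.map_eq
  rw [← h2, integral_map h.measurable.aemeasurable B.continuous.aestronglyMeasurable]
  rfl

theorem integrable_coeFn (f : L2Torus) : Integrable f torusMeasure :=
  (Lp.memLp f).integrable (by norm_num)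

theorem integral_lift_add_add_conj (B : C(UnitAddCircle, ℂ)) {F F' : L2Torus}
    (hF : mean F = 0) (hF' : mean F' = 0) :
    ∫ x, (lift B x + F x + conj (F' x)) ∂torusMeasure = ∫ t, B t ∂AddCircle.haarAddCircle := by
  have i1 : Integrable (lift B) torusMeasure :=
    (lift B).continuous.integrable_of_hasCompactSupport (HasCompactSupport.of_compactSpace _)
  have i2 := integrable_coeFn F
  have i3 : Integrable (fun x => conj (F' x)) torusMeasure :=
    (Complex.conjLIE.toContinuousLinearEquiv.toContinuousLinearMap).integrable_comp
      (integrable_coeFn F')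
  rw [mean_eq_integral] at hF hF'
  rw [integral_add (f := fun x => lift B x + F x) (i1.add i2) i3, integral_add i1 i2, integral_coord_one, integral_conj, hF, hF',
    map_zero, add_zero, add_zero]

/-- `q = 1 + c + c z₂` on the circle. -/
def qC (c : ℝ) : C(UnitAddCircle, ℂ) := (1 + c : ℂ) • 1 + (c : ℂ) • fourier 1

/-- `1 + z₂` on the circle. -/
def yCircle : C(UnitAddCircle, ℂ) := 1 + fourier 1

theorem lift_yCircle : lift yCircle = yC := by
  rw [yCircle, map_add, map_one, lift_fourier_one, yC]

theorem pC_eq_qC_sub (c : ℝ) (x : Torus) : pC c x = lift (qC c) x - coord 0 x := by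
  have : lift (qC c) = (1 + c : ℂ) • 1 + (c : ℂ) • coord 1 := by
    rw [qC, map_add, map_smul, map_smul, map_one, lift_fourier_one]
  rw [this, pC]
  simp only [ContinuousMap.add_apply, ContinuousMap.sub_apply]
  ring

/-- Both sides equal |q|² - 1. Divided by |p|² = |q - z₁|² this is a Poisson kernel in z₁, namely 1
+ z₁/p + z̄₁/p̄, whose mean part is 1. -/
theorem c_mul_yC_mul_conj (c : ℝ) (x : Torus) :
    (c * (1 + c) : ℂ) * (yC x * conj (yC x)) =
      lift (qC c) x * conj (pC c x) + conj (coord 0 x) * pC c x := by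
  have : lift (qC c) x = pC c x + coord 0 x := by rw [pC_eq_qC_sub]; ring
  rw [this, conj_pC, conj_yC, pC_apply, yC_apply]
  linear_combination (-(c : ℂ) ^ 2 + c * (1 + c)) * coord_mul_conj 1 x + coord_mul_conj 0 x

/-- The multiplier `g q² (p + β p̃)`, where `p̃` is the reflection of `p`. -/
def testMultiplier (c : ℝ) (β : ℂ) (g : C(UnitAddCircle, ℂ)) : C(Torus, ℂ) :=
  lift (g * qC c ^ 2) * (lift (qC c) - β • coord 1) +
    lift (g * qC c ^ 2) * (β • ((1 + c : ℂ) • coord 1 + (c : ℂ) • 1) - 1) * coord 0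

theorem testMultiplier_apply (c : ℝ) (β : ℂ) (g : C(UnitAddCircle, ℂ)) (x : Torus) :
    testMultiplier c β g x = lift g x * lift (qC c) x ^ 2 *
      (pC c x + β * coord 0 x * coord 1 x * conj (pC c x)) := by
  rw [conj_pC, pC_eq_qC_sub, testMultiplier, map_mul, map_pow]
  simp only [ContinuousMap.add_apply, ContinuousMap.sub_apply, ContinuousMap.mul_apply,
    ContinuousMap.smul_apply, ContinuousMap.pow_apply, ContinuousMap.one_apply, smul_eq_mul]
  linear_combination (lift g x * lift (qC c) x ^ 2 * β * coord 1 x) * coord_mul_conj 0 x -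
    (lift g x * lift (qC c) x ^ 2 * β * coord 0 x * c) * coord_mul_conj 1 x

theorem mulOp_testMultiplier_mem {c : ℝ} {S : Submodule ℂ L2Torus}
    (hinv : ∀ f ∈ S, shift 1 f ∈ S) {e : L2Torus} (he : e ∈ S) (he' : mulOp (coord 0) e ∈ S)
    (β : ℂ) {g : C(UnitAddCircle, ℂ)} (hg : lift g ∈ Algebra.adjoin ℂ {coord 1}) :
    mulOp (testMultiplier c β g) e ∈ S := by
  have h1 : coord 1 ∈ Algebra.adjoin ℂ {coord 1} := Algebra.subset_adjoin rfl
  have hq : lift (qC c) ∈ Algebra.adjoin ℂ {coord 1} := by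
    rw [qC, map_add, map_smul, map_smul, map_one, lift_fourier_one]
    exact add_mem (Subalgebra.smul_mem _ (one_mem _) _) (Subalgebra.smul_mem _ h1 _)
  have hgq : lift (g * qC c ^ 2) ∈ Algebra.adjoin ℂ {coord 1} := by
    rw [map_mul, map_pow]; exact mul_mem hg (pow_mem hq 2)
  have hi : ∀ φ ∈ ({coord 1} : Set C(Torus, ℂ)), ∀ f ∈ S, mulOp φ f ∈ S := by
    rintro _ rfl f hf; exact hinv f hf
  rw [testMultiplier, mulOp_add, mulOp_mul _ (coord 0)]
  refine S.add_mem (mulOp_mem_of_mem_adjoin hi ?_ _ he) (mulOp_mem_of_mem_adjoin hi ?_ _ he')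
  · exact mul_mem hgq (sub_mem hq (Subalgebra.smul_mem _ h1 _))
  · exact mul_mem hgq (sub_mem (Subalgebra.smul_mem _ (add_mem (Subalgebra.smul_mem _ h1 _)
      (Subalgebra.smul_mem _ (one_mem _) _)) _) (one_mem _))

/-- As |βz₁z₂| = 1, both square terms of |p + βp̃|² equal |p|², and each cross term cancels p² or
p̄² entirely. -/
theorem quotient_identity {β β' z₁ w₁ z₂ w₂ p p' i j : ℂ} (hβ : β * β' = 1) (h0 : z₁ * w₁ = 1)
    (h1 : z₂ * w₂ = 1) (hj : p * j = 1) (hi : p' * i = 1) :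
    (p + β * z₁ * z₂ * p') * (p' + β' * w₁ * w₂ * p) * (j ^ 2 * i ^ 2) =
      2 * (j * i) + β * z₁ * z₂ * j ^ 2 + β' * w₁ * w₂ * i ^ 2 := by
  have e1 : (p + β * z₁ * z₂ * p') * (p' + β' * w₁ * w₂ * p) =
      2 * (p * p') + β * z₁ * z₂ * p' ^ 2 + β' * w₁ * w₂ * p ^ 2 := by
    have hu : β * β' * (z₁ * w₁) * (z₂ * w₂) = 1 := by rw [hβ, h0, h1]; ring
    linear_combination p * p' * hu
  linear_combination (j ^ 2 * i ^ 2) * e1 + (2 * j * i * (p' * i)) * hj + 2 * j * i * hi +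
    β * z₁ * z₂ * j ^ 2 * (p' * i + 1) * hi + β' * w₁ * w₂ * i ^ 2 * (p * j + 1) * hj

/-- Inserting the Poisson kernel leaves a function of z₂ alone, plus terms with a spare z₁ next to
y²/p or y⁴/p² and conjugates of such terms; the latter two groups have mean zero. -/
theorem norm_identity {s g g' q q' y y' β β' z₁ w₁ z₂ w₂ p p' i j : ℂ} (hβ : β * β' = 1)
    (h0 : z₁ * w₁ = 1) (h1 : z₂ * w₂ = 1) (hj : p * j = 1) (hi : p' * i = 1)
    (hp : p = q - z₁) (hs : s * (y * y') = q * p' + w₁ * p) :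
    s * ((g' * q' ^ 2 * (p' + β' * w₁ * w₂ * p) * (y' ^ 4 * i ^ 2)) *
      (g * q ^ 2 * (p + β * z₁ * z₂ * p') * (y ^ 4 * j ^ 2))) =
      2 * (g * g' * (q * q') ^ 2 * (y * y') ^ 3) +
      (2 * (g * g' * (q * q') ^ 2 * y * y' ^ 3) * z₁ * (y ^ 2 * j) +
        s * β * (g * g' * (q * q') ^ 2 * y' ^ 4 * z₂) * z₁ * (y ^ 4 * j ^ 2)) +
      (2 * (g * g' * (q * q') ^ 2 * y' * y ^ 3) * w₁ * (y' ^ 2 * i) +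
        s * β' * (g * g' * (q * q') ^ 2 * y ^ 4 * w₂) * w₁ * (y' ^ 4 * i ^ 2)) := by
  have e2 := quotient_identity hβ h0 h1 hj hi
  have e3 : s * (y * y') * (j * i) = 1 + z₁ * j + w₁ * i := by
    rw [hs]
    linear_combination (q * j) * hi + (w₁ * i + 1) * hj - j * hp
  linear_combination (s * (g * g' * (q * q') ^ 2 * (y * y') ^ 4)) * e2 +
    (2 * (g * g' * (q * q') ^ 2 * (y * y') ^ 3)) * e3

/-- The extra z₁ turns z̄₁/p̄ into 1/p̄, whose z₁-mean 1/q̄ no longer vanishes. The constant part is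
isolated by q̄/p̄ = 1 + z̄₁/p̄ and its square, which is why the test multiplier carries q². -/
theorem shift_identity {s g g' q q' y y' β β' z₁ w₁ z₂ w₂ p p' i j : ℂ} (hβ : β * β' = 1)
    (h0 : z₁ * w₁ = 1) (h1 : z₂ * w₂ = 1) (hj : p * j = 1) (hi : p' * i = 1)
    (hp : p = q - z₁) (hp' : p' = q' - w₁) (hs : s * (y * y') = q * p' + w₁ * p) :
    s * ((g' * q' ^ 2 * (p' + β' * w₁ * w₂ * p) * (y' ^ 4 * i ^ 2)) *
      (z₁ * (g * q ^ 2 * (p + β * z₁ * z₂ * p') * (y ^ 4 * j ^ 2)))) =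
      (2 * (g * g' * q ^ 2 * q' * (y * y') ^ 3) +
        s * β' * (g * g' * q ^ 2 * (y * y') ^ 4 * w₂)) +
      (2 * (g * g' * (q * q') ^ 2 * (y * y') ^ 3) * z₁ +
        2 * (g * g' * (q * q') ^ 2 * y * y' ^ 3) * z₁ * z₁ * (y ^ 2 * j) +
        s * β * (g * g' * (q * q') ^ 2 * y' ^ 4 * z₂) * z₁ * z₁ * (y ^ 4 * j ^ 2)) +
      (2 * (g * g' * q ^ 2 * q' * y' * y ^ 3) * w₁ * (y' ^ 2 * i) +
        2 * s * β' * (g * g' * q ^ 2 * y' ^ 2 * y ^ 4 * w₂) * w₁ * (y' ^ 2 * i) +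
        s * β' * (g * g' * q ^ 2 * y ^ 4 * w₂) * w₁ * w₁ * (y' ^ 4 * i ^ 2)) := by
  have e := norm_identity (g := g) (g' := g') (q' := q') hβ h0 h1 hj hi hp hs
  have e4 : q' * i = 1 + w₁ * i := by linear_combination hi - i * hp'
  have e5 : (q' * i) ^ 2 = 1 + 2 * w₁ * i + w₁ ^ 2 * i ^ 2 := by rw [e4]; ring
  have e6 : z₁ * (w₁ * i) = i := by linear_combination i * h0
  linear_combination z₁ * e + 2 * (g * g' * q ^ 2 * q' * (y * y') ^ 3) * e4 +
    2 * (g * g' * (q * q') ^ 2 * (y * y') ^ 3) * e6 +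
    (s * β' * (g * g' * q ^ 2 * (y * y') ^ 4 * w₂)) * e5 +
    (s * β' * (g * g' * (q * q') ^ 2 * (y * y') ^ 4 * w₂) * i) * e6

theorem constOne_mem_hardy : constOne ∈ hardy := monomial_mem_hardy 0 0

theorem lift_mul_coord_zero_mean (B : C(UnitAddCircle, ℂ)) {f : L2Torus} (hf : f ∈ hardy) :
    mean (mulOp (lift B * coord 0) f) = 0 :=
  mean_mulOp_mul_coord_zero (lift_mem_leftAnalytic B) hf

theorem inner_testMultiplier_self {c : ℝ} (hc : 0 < c) {β : ℂ} (hβ : ‖β‖ = 1) {b e : L2Torus}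
    (hb : b ∈ hardy) (hb' : b =ᵐ[torusMeasure] fun x => yC x ^ 2 / pC c x)
    (he : e ∈ hardy) (he' : e =ᵐ[torusMeasure] fun x => yC x ^ 4 / pC c x ^ 2)
    (g : C(UnitAddCircle, ℂ)) :
    (c * (1 + c) : ℂ) *
      inner ℂ (mulOp (testMultiplier c β g) e) (mulOp (testMultiplier c β g) e) =
    ∫ t, ((2 : ℂ) • (g * star g * (qC c * star (qC c)) ^ 2 * (yCircle * star yCircle) ^ 3)) t
      ∂AddCircle.haarAddCircle := by
  set s : ℂ := c * (1 + c) with hs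
  have hββ : β * conj β = 1 := by rw [Complex.mul_conj, Complex.normSq_eq_norm_sq, hβ]; simp
  set Q := g * star g * (qC c * star (qC c)) ^ 2 with hQ
  set F : L2Torus := mulOp (lift ((2 : ℂ) • (Q * yCircle * star yCircle ^ 3)) * coord 0) b +
    mulOp (lift ((s * β) • (Q * star yCircle ^ 4 * fourier 1)) * coord 0) e with hF
  have hF0 : mean F = 0 := by
    rw [hF, map_add, lift_mul_coord_zero_mean _ hb, lift_mul_coord_zero_mean _ he, add_zero]
  rw [inner_eq_integral, ← integral_const_mul, ← integral_lift_add_add_conj _ hF0 hF0]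
  refine integral_congr_ae ?_
  filter_upwards [mulOp_coeFn (testMultiplier c β g) e,
    Lp.coeFn_add (mulOp (lift ((2 : ℂ) • (Q * yCircle * star yCircle ^ 3)) * coord 0) b)
      (mulOp (lift ((s * β) • (Q * star yCircle ^ 4 * fourier 1)) * coord 0) e),
    mulOp_coeFn (lift ((2 : ℂ) • (Q * yCircle * star yCircle ^ 3)) * coord 0) b,
    mulOp_coeFn (lift ((s * β) • (Q * star yCircle ^ 4 * fourier 1)) * coord 0) e,
    hb', he', ae_pC_ne_zero hc] with x a1 a2 a3 a4 a5 a6 a7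
  rw [a2, Pi.add_apply, a1, a3, a4, a5, a6, testMultiplier_apply]
  have key := norm_identity (g := lift g x) (g' := conj (lift g x))
    (q' := conj (lift (qC c) x)) hββ (coord_mul_conj 0 x) (coord_mul_conj 1 x)
    (mul_inv_cancel₀ a7) (mul_inv_cancel₀ ((map_ne_zero (starRingEnd ℂ)).2 a7))
    (pC_eq_qC_sub c x) (c_mul_yC_mul_conj c x)
  have hsc : conj s = s := by rw [hs]; simp
  simp only [hQ, map_add, map_mul, map_pow, map_smul, map_star,
    ContinuousMap.mul_apply, ContinuousMap.smul_apply, ContinuousMap.pow_apply, smul_eq_mul,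
    ContinuousMap.star_apply, lift_yCircle, lift_fourier_one, ← starRingEnd_apply,
    Complex.conj_conj, div_eq_mul_inv, map_inv₀, map_ofNat, ← inv_pow, hsc]
  linear_combination key

theorem inner_testMultiplier_shift {c : ℝ} (hc : 0 < c) {β : ℂ} (hβ : ‖β‖ = 1) {b e : L2Torus}
    (hb : b ∈ hardy) (hb' : b =ᵐ[torusMeasure] fun x => yC x ^ 2 / pC c x)
    (he : e ∈ hardy) (he' : e =ᵐ[torusMeasure] fun x => yC x ^ 4 / pC c x ^ 2)
    (g : C(UnitAddCircle, ℂ)) :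
    (c * (1 + c) : ℂ) *
      inner ℂ (mulOp (testMultiplier c β g) e) (shift 0 (mulOp (testMultiplier c β g) e)) =
    ∫ t, ((2 : ℂ) • (g * star g * qC c ^ 2 * star (qC c) * (yCircle * star yCircle) ^ 3) +
      (c * (1 + c) * conj β : ℂ) • (g * star g * qC c ^ 2 * (yCircle * star yCircle) ^ 4 *
        star (fourier 1)) : C(UnitAddCircle, ℂ)) t ∂AddCircle.haarAddCircle := by
  set s : ℂ := c * (1 + c) with hs
  have hββ : β * conj β = 1 := by rw [Complex.mul_conj, Complex.normSq_eq_norm_sq, hβ]; simp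
  set Q := g * star g * (qC c * star (qC c)) ^ 2 with hQ
  set R := g * star g * star (qC c) ^ 2 with hR
  set B₁ := (2 : ℂ) • (Q * (yCircle * star yCircle) ^ 3) with hB₁
  set B₂ := (2 : ℂ) • (Q * yCircle * star yCircle ^ 3) with hB₂
  set B₃ := (s * β) • (Q * star yCircle ^ 4 * fourier 1) with hB₃
  set B₄ := (2 : ℂ) • (R * qC c * yCircle * star yCircle ^ 3) +
    (2 * s * β) • (R * yCircle ^ 2 * star yCircle ^ 4 * fourier 1) with hB₄
  set B₅ := (s * β) • (R * star yCircle ^ 4 * fourier 1) with hB₅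
  have hz : ∀ {f : L2Torus}, f ∈ hardy → mulOp (coord 0) f ∈ hardy := fun hf =>
    shift_mem_hardy 0 hf
  set F : L2Torus := mulOp (lift B₁ * coord 0) constOne +
    mulOp (lift B₂ * coord 0) (mulOp (coord 0) b) +
    mulOp (lift B₃ * coord 0) (mulOp (coord 0) e) with hF
  set F' : L2Torus := mulOp (lift B₄ * coord 0) b +
    mulOp (lift B₅ * coord 0) (mulOp (coord 0) e) with hF'
  have hF0 : mean F = 0 := by
    rw [hF, map_add, map_add, lift_mul_coord_zero_mean _ constOne_mem_hardy,
      lift_mul_coord_zero_mean _ (hz hb), lift_mul_coord_zero_mean _ (hz he), add_zero, add_zero]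
  have hF0' : mean F' = 0 := by
    rw [hF', map_add, lift_mul_coord_zero_mean _ hb, lift_mul_coord_zero_mean _ (hz he), add_zero]
  rw [inner_eq_integral, ← integral_const_mul, ← integral_lift_add_add_conj _ hF0 hF0']
  refine integral_congr_ae ?_
  filter_upwards [mulOp_coeFn (testMultiplier c β g) e,
    mulOp_coeFn (coord 0) (mulOp (testMultiplier c β g) e),
    Lp.coeFn_add (mulOp (lift B₁ * coord 0) constOne +
      mulOp (lift B₂ * coord 0) (mulOp (coord 0) b))
      (mulOp (lift B₃ * coord 0) (mulOp (coord 0) e)),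
    Lp.coeFn_add (mulOp (lift B₁ * coord 0) constOne)
      (mulOp (lift B₂ * coord 0) (mulOp (coord 0) b)),
    mulOp_constOne_coeFn (lift B₁ * coord 0),
    mulOp_coeFn (lift B₂ * coord 0) (mulOp (coord 0) b),
    mulOp_coeFn (lift B₃ * coord 0) (mulOp (coord 0) e),
    mulOp_coeFn (coord 0) b, mulOp_coeFn (coord 0) e,
    Lp.coeFn_add (mulOp (lift B₄ * coord 0) b) (mulOp (lift B₅ * coord 0) (mulOp (coord 0) e)),
    mulOp_coeFn (lift B₄ * coord 0) b,
    mulOp_coeFn (lift B₅ * coord 0) (mulOp (coord 0) e),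
    hb', he', ae_pC_ne_zero hc] with x a1 a2 a3 a4 a5 a6 a7 a8 a9 a10 a11 a12 hbx hex hpx
  rw [shift, a2, a1, a3, Pi.add_apply, a4, Pi.add_apply, a5, a6, a7, a8, a9, a10, Pi.add_apply,
    a11, a12, a9, hbx, hex, testMultiplier_apply]
  have key := shift_identity (g := lift g x) (g' := conj (lift g x))
    (q' := conj (lift (qC c) x)) hββ (coord_mul_conj 0 x) (coord_mul_conj 1 x)
    (mul_inv_cancel₀ hpx) (mul_inv_cancel₀ ((map_ne_zero (starRingEnd ℂ)).2 hpx))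
    (pC_eq_qC_sub c x) (by rw [pC_eq_qC_sub, map_sub]) (c_mul_yC_mul_conj c x)
  have hsc : conj s = s := by rw [hs]; simp
  simp only [hQ, hR, hB₁, hB₂, hB₃, hB₄, hB₅, map_add, map_mul, map_pow, map_smul, map_star,
    ContinuousMap.add_apply, ContinuousMap.mul_apply, ContinuousMap.smul_apply,
    ContinuousMap.pow_apply, smul_eq_mul, ContinuousMap.star_apply, lift_yCircle,
    lift_fourier_one, ← starRingEnd_apply, Complex.conj_conj, div_eq_mul_inv, map_inv₀,
    map_ofNat, ← inv_pow, hsc]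
  linear_combination key

/-! ### Peaking on the circle -/

/-- The weights |1 + τ̄z|²ⁿ, with τ the point of the circle at t₀, have their unique maximum at τ
and after normalization concentrate there. -/
theorem re_nonneg_of_integral_nonneg (Ψ : C(UnitAddCircle, ℂ)) (t₀ : UnitAddCircle)
    (h : ∀ n : ℕ, 0 ≤ (∫ t, (((1 + conj (fourier 1 t₀) • fourier 1) ^ n *
      star ((1 + conj (fourier 1 t₀) • fourier 1) ^ n)) * Ψ : C(UnitAddCircle, ℂ)) t ∂AddCircle.haarAddCircle).re) :
    0 ≤ (Ψ t₀).re := by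
  set k : C(UnitAddCircle, ℂ) := 1 + conj (fourier 1 t₀) • fourier 1 with hk
  set C : UnitAddCircle → ℝ := fun t => ‖k t‖ ^ 2 with hC
  have hnorm : ∀ t : UnitAddCircle, ‖fourier 1 t‖ = 1 := fun t => by
    rw [fourier_one]; exact Circle.norm_coe _
  have hk0 : k t₀ = 2 := by
    simp only [hk, ContinuousMap.add_apply, ContinuousMap.one_apply, ContinuousMap.smul_apply,
      smul_eq_mul]
    rw [← Complex.normSq_eq_conj_mul_self, Complex.normSq_eq_norm_sq, hnorm]; norm_num
  have hmax : ∀ t ∈ Set.univ, t ≠ t₀ → C t < C t₀ := by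
    intro t _ ht
    set ζ : ℂ := conj (fourier 1 t₀) * fourier 1 t with hζ
    have hζn : ζ.re ^ 2 + ζ.im ^ 2 = 1 := by
      have : ‖ζ‖ ^ 2 = 1 := by rw [hζ, norm_mul, RCLike.norm_conj, hnorm, hnorm]; norm_num
      rw [Complex.sq_norm, Complex.normSq_apply] at this
      linarith
    have hζ1 : ζ ≠ 1 := by
      intro h1
      apply ht
      apply AddCircle.injective_toCircle one_ne_zero
      apply Circle.ext
      rw [← fourier_one, ← fourier_one]
      have h2 : fourier 1 t₀ * conj (fourier 1 t₀) = 1 := by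
        rw [Complex.mul_conj, Complex.normSq_eq_norm_sq, hnorm]; norm_num
      linear_combination fourier 1 t₀ * (h1 : conj (fourier 1 t₀) * fourier 1 t = 1) -
        fourier 1 t * h2
    have hre : ζ.re < 1 := by
      by_contra! h1
      have h2 : ζ.re = 1 := by nlinarith [sq_nonneg ζ.im]
      have h3 : ζ.im = 0 := by rw [h2] at hζn; nlinarith
      exact hζ1 (Complex.ext h2 h3)
    have hkt : k t = 1 + ζ := by
      simp [hk, hζ]
    simp only [hC]
    rw [hk0, hkt, Complex.sq_norm, Complex.normSq_apply]
    simp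
    nlinarith
  have hlim := tendsto_setIntegral_pow_smul_of_unique_maximum_of_isCompact_of_continuousOn
    (μ := (AddCircle.haarAddCircle : Measure UnitAddCircle)) (s := Set.univ) isCompact_univ
    (c := C) (g := fun t => (Ψ t).re) (x₀ := t₀) (by fun_prop) hmax (fun t _ => by positivity)
    (by simp [hC, hk0]) (by simp) (by fun_prop)
  refine ge_of_tendsto hlim (Eventually.of_forall fun n => ?_)
  rw [Measure.restrict_univ]
  refine smul_nonneg (inv_nonneg.2 (integral_nonneg fun t => by positivity)) ?_
  refine (h n).trans_eq ?_
  have hint : Integrable (fun t => ((k ^ n * star (k ^ n)) * Ψ) t)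
      (AddCircle.haarAddCircle : Measure UnitAddCircle) :=
    (ContinuousMap.continuous _).integrable_of_hasCompactSupport (HasCompactSupport.of_compactSpace _)
  rw [← RCLike.re_to_complex, ← integral_re hint]
  refine integral_congr_ae (Eventually.of_forall fun t => ?_)
  simp only [ContinuousMap.mul_apply, ContinuousMap.star_apply, ContinuousMap.pow_apply,
    RCLike.re_to_complex, smul_eq_mul, hC]
  rw [← starRingEnd_apply, Complex.mul_conj, Complex.normSq_eq_norm_sq, norm_pow,
    Complex.re_ofReal_mul, ← pow_mul, ← pow_mul, mul_comm n 2]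

/-! ### Support lines of the numerical range -/

theorem inner_compressedShift (S : Submodule ℂ L2Torus) [S.HasOrthogonalProjection] (h : S) :
    inner ℂ h (compressedShift S h) = inner ℂ (h : L2Torus) (shift 0 h) := by
  change inner ℂ h (S.orthogonalProjectionOnto (shift 0 h)) = _
  rw [Submodule.inner_orthogonalProjectionOnto_eq_of_mem_left]

theorem re_inner_shift_le {S : Submodule ℂ L2Torus} [S.HasOrthogonalProjection] {w : ℂ} {r : ℝ}
    (hW : closure (numericalRange (compressedShift S)) ⊆ Metric.closedBall w r) {d : ℂ}
    (hd : ‖d‖ = 1) {h : L2Torus} (hh : h ∈ S) :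
    (conj d * inner ℂ h (shift 0 h)).re ≤ (r + (conj d * w).re) * ‖h‖ ^ 2 := by
  by_cases h0 : h = 0
  · simp [h0]
  have hn : 0 < ‖h‖ := norm_pos_iff.2 h0
  set u : S := (‖h‖⁻¹ : ℂ) • ⟨h, hh⟩ with hu
  have hun : ‖u‖ = 1 := by
    rw [hu, norm_smul, norm_inv, Complex.norm_real, norm_norm]
    exact inv_mul_cancel₀ hn.ne'
  have hmem := hW (subset_closure ⟨u, hun, rfl⟩)
  rw [Metric.mem_closedBall, dist_eq_norm, inner_compressedShift] at hmem
  have e : inner ℂ (u : L2Torus) (shift 0 u) =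
      ((‖h‖ ^ 2)⁻¹ : ℝ) * inner ℂ h (shift 0 h) := by
    have : (u : L2Torus) = (‖h‖⁻¹ : ℂ) • h := rfl
    rw [this, map_smul, inner_smul_left, inner_smul_right, map_inv₀, Complex.conj_ofReal]
    push_cast
    ring
  rw [e] at hmem
  have h1 : (conj d * (((‖h‖ ^ 2)⁻¹ : ℝ) * inner ℂ h (shift 0 h) - w)).re ≤ r := by
    refine (Complex.re_le_norm _).trans ?_
    rwa [norm_mul, RCLike.norm_conj, hd, one_mul]
  have h2 : (conj d * (((‖h‖ ^ 2)⁻¹ : ℝ) * inner ℂ h (shift 0 h) - w)).re =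
      (‖h‖ ^ 2)⁻¹ * (conj d * inner ℂ h (shift 0 h)).re - (conj d * w).re := by
    rw [mul_sub, Complex.sub_re, ← Complex.re_ofReal_mul]
    congr 2; ring
  rw [h2] at h1
  have h3 : (‖h‖ ^ 2)⁻¹ * (conj d * inner ℂ h (shift 0 h)).re ≤ r + (conj d * w).re := by linarith
  rwa [inv_mul_le_iff₀ (by positivity), mul_comm (‖h‖ ^ 2)] at h3

theorem norm_fourier_one (t : UnitAddCircle) : ‖fourier 1 t‖ = 1 := by
  rw [fourier_one]; exact Circle.norm_coe _

theorem fourier_one_mul_conj (t : UnitAddCircle) : fourier 1 t * conj (fourier 1 t) = 1 := by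
  rw [Complex.mul_conj, Complex.normSq_eq_norm_sq, norm_fourier_one]; norm_num

theorem qC_apply (c : ℝ) (t : UnitAddCircle) : qC c t = 1 + c + c * fourier 1 t := by
  simp [qC]

theorem norm_qC_sq (c : ℝ) (t : UnitAddCircle) :
    ‖qC c t‖ ^ 2 = 1 + 2 * (c * (1 + c)) * (1 + (fourier 1 t : ℂ).re) := by
  have h : (fourier 1 t : ℂ).re ^ 2 + (fourier 1 t : ℂ).im ^ 2 = 1 := by
    have := congrArg (· ^ 2) (norm_fourier_one t)
    simp only [Complex.sq_norm, Complex.normSq_apply, one_pow] at this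
    linarith
  rw [Complex.sq_norm, Complex.normSq_apply, qC_apply]
  simp only [Complex.add_re, Complex.one_re, Complex.ofReal_re, Complex.re_ofReal_mul,
    Complex.add_im, Complex.one_im, Complex.ofReal_im, Complex.im_ofReal_mul]
  linear_combination c ^ 2 * h

theorem yCircle_mul_conj (t : UnitAddCircle) :
    yCircle t * conj (yCircle t) = ((2 * (1 + (fourier 1 t : ℂ).re) : ℝ) : ℂ) := by
  have h := fourier_one_mul_conj t
  have h2 := Complex.add_conj (fourier 1 t : ℂ)
  simp only [yCircle, ContinuousMap.add_apply, ContinuousMap.one_apply, map_add, map_one]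
  push_cast at h2 ⊢
  linear_combination h + h2

theorem norm_qC_pos {c : ℝ} (hc : 0 < c) {t : UnitAddCircle} (ht : -1 < (fourier 1 t : ℂ).re) :
    0 < ‖qC c t‖ := by
  have hY : 0 < 1 + (fourier 1 t : ℂ).re := by linarith
  have : 0 < ‖qC c t‖ ^ 2 := by rw [norm_qC_sq]; positivity
  exact (norm_nonneg _).lt_of_ne' fun h => by simp [h] at this

/-- The density of the form `s ‖h‖² - conj d ⟨h, z₁ h⟩` on the test functions. -/
def supportDensity (c s : ℝ) (d β : ℂ) : C(UnitAddCircle, ℂ) :=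
  (2 * s : ℂ) • ((qC c * star (qC c)) ^ 2 * (yCircle * star yCircle) ^ 3) -
    conj d • ((2 : ℂ) • (qC c ^ 2 * star (qC c) * (yCircle * star yCircle) ^ 3) +
      (c * (1 + c) * conj β : ℂ) • (qC c ^ 2 * (yCircle * star yCircle) ^ 4 *
        star (fourier 1)))

theorem integral_supportDensity {c : ℝ} (hc : 0 < c) (s : ℝ) (d : ℂ) {β : ℂ} (hβ : ‖β‖ = 1)
    {b e : L2Torus}
    (hb : b ∈ hardy) (hb' : b =ᵐ[torusMeasure] fun x => yC x ^ 2 / pC c x)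
    (he : e ∈ hardy) (he' : e =ᵐ[torusMeasure] fun x => yC x ^ 4 / pC c x ^ 2)
    (g : C(UnitAddCircle, ℂ)) {h : L2Torus} (hh : h = mulOp (testMultiplier c β g) e) :
    ∫ t, (g * star g * supportDensity c s d β) t ∂AddCircle.haarAddCircle =
      ((c * (1 + c) : ℝ) : ℂ) * (s * (‖h‖ ^ 2 : ℝ) - conj d * inner ℂ h (shift 0 h)) := by
  have i1 := inner_testMultiplier_self hc hβ hb hb' he he' g
  have i2 := inner_testMultiplier_shift hc hβ hb hb' he he' g
  rw [← hh] at i1 i2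
  have hint : ∀ D : C(UnitAddCircle, ℂ), Integrable D
      (AddCircle.haarAddCircle : Measure UnitAddCircle) := fun D =>
    D.continuous.integrable_of_hasCompactSupport (HasCompactSupport.of_compactSpace _)
  have e2 : ((c * (1 + c) : ℝ) : ℂ) * (s * (‖h‖ ^ 2 : ℝ) - conj d * inner ℂ h (shift 0 h)) =
      s * (c * (1 + c) * inner ℂ h h) - conj d * (c * (1 + c) * inner ℂ h (shift 0 h)) := by
    rw [inner_self_eq_norm_sq_to_K]
    push_cast
    simp only [Complex.coe_algebraMap]
    ring
  rw [e2, i1, i2, ← integral_const_mul, ← integral_const_mul,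
    ← integral_sub ((hint _).const_mul _) ((hint _).const_mul _)]
  refine integral_congr_ae (Eventually.of_forall fun t => ?_)
  simp only [supportDensity, ContinuousMap.add_apply, ContinuousMap.sub_apply,
    ContinuousMap.mul_apply, ContinuousMap.smul_apply, smul_eq_mul]
  ring

theorem supportDensity_nonneg {c : ℝ} (hc : 0 < c) {S₁ S₂ : Submodule ℂ L2Torus}
    [S₂.HasOrthogonalProjection]
    (hS : IsShiftDecomposition (bigTheta (1 + c) c) S₁ S₂) {w : ℂ} {r : ℝ}
    (hW : closure (numericalRange (compressedShift S₂)) ⊆ Metric.closedBall w r)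
    {d β : ℂ} (hd : ‖d‖ = 1) (hβ : ‖β‖ = 1) (t₀ : UnitAddCircle) :
    0 ≤ (supportDensity c (r + (conj d * w).re) d β t₀).re := by
  obtain ⟨b, hb, hb'⟩ := exists_hardy_eq_sq_div hc
  obtain ⟨e, he, he'⟩ := exists_hardy_eq_pow_four_div hc
  obtain ⟨heS, hzeS⟩ := mem_of_isShiftDecomposition hc hS he he'
  refine re_nonneg_of_integral_nonneg _ t₀ fun n => ?_
  have hgm : lift ((1 + conj (fourier 1 t₀) • fourier 1) ^ n) ∈ Algebra.adjoin ℂ {coord 1} := by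
    have h1 : coord 1 ∈ Algebra.adjoin ℂ {coord 1} := Algebra.subset_adjoin rfl
    rw [map_pow, map_add, map_one, map_smul, lift_fourier_one]
    exact pow_mem (add_mem (one_mem _) (Subalgebra.smul_mem _ h1 _)) n
  have hle := re_inner_shift_le hW hd (mulOp_testMultiplier_mem (c := c) hS.invariant₂ heS hzeS β hgm)
  rw [integral_supportDensity hc _ d hβ hb hb' he he' _ rfl, Complex.re_ofReal_mul,
    Complex.sub_re, Complex.re_ofReal_mul, Complex.ofReal_re]
  have : 0 ≤ c * (1 + c) := by positivity
  exact mul_nonneg this (sub_nonneg.2 hle)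

/-- With m = |q| and d = q/m, division by 2m² gives 1/m + (1 - 1/m²)/2 ≤ r + Re(d̄w). The left side
is the support value of the fibre disk, with centre 1/q̄, in the direction of that centre. -/
theorem two_norm_add_le {c : ℝ} (hc : 0 < c) {S₁ S₂ : Submodule ℂ L2Torus}
    [S₂.HasOrthogonalProjection]
    (hS : IsShiftDecomposition (bigTheta (1 + c) c) S₁ S₂) {w : ℂ} {r : ℝ}
    (hW : closure (numericalRange (compressedShift S₂)) ⊆ Metric.closedBall w r)
    (t₀ : UnitAddCircle) (ht₀ : -1 < (fourier 1 t₀ : ℂ).re) :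
    2 * ‖qC c t₀‖ + ‖qC c t₀‖ ^ 2 - 1 ≤
      2 * r * ‖qC c t₀‖ ^ 2 + 2 * ‖qC c t₀‖ * (conj (qC c t₀) * w).re := by
  set q := qC c t₀ with hq
  set m := ‖q‖ with hm
  have hmsq : m ^ 2 = 1 + 2 * (c * (1 + c)) * (1 + (fourier 1 t₀ : ℂ).re) := norm_qC_sq c t₀
  have hY : 0 < 1 + (fourier 1 t₀ : ℂ).re := by linarith
  have hm0 : 0 < m := norm_qC_pos hc ht₀
  set d : ℂ := q / m with hd
  have hdn : ‖d‖ = 1 := by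
    rw [hd, norm_div, Complex.norm_real, Real.norm_of_nonneg hm0.le]
    exact div_self hm0.ne'
  set τ : ℂ := fourier 1 t₀ with hτ
  -- This phase gives β̄τ̄ = d̄, aligning the β-term of the quadratic form with the direction d.
  set β : ℂ := conj τ * d with hβ
  have hβn : ‖β‖ = 1 := by rw [hβ, norm_mul, RCLike.norm_conj, norm_fourier_one, hdn, one_mul]
  set r' : ℝ := r + (conj d * w).re with hr'
  have hpos := supportDensity_nonneg hc hS hW hdn hβn t₀
  rw [← hr'] at hpos
  have hqq : q * conj q = (m : ℂ) ^ 2 := by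
    rw [Complex.mul_conj, Complex.normSq_eq_norm_sq, hm]; push_cast; rfl
  have hmC : (m : ℂ) ≠ 0 := by exact_mod_cast hm0.ne'
  have hdq : conj d * q = m := by
    rw [hd, map_div₀, Complex.conj_ofReal, div_mul_eq_mul_div, mul_comm, hqq]
    field_simp
  have hββ : conj β * conj τ = conj d := by
    rw [hβ, map_mul, Complex.conj_conj]
    linear_combination conj d * fourier_one_mul_conj t₀
  set Y : ℝ := 2 * (1 + τ.re) with hYdef
  have hval : supportDensity c r' d β t₀ =
      ((Y ^ 3 * (2 * r' * m ^ 4 - 2 * m ^ 3 - c * (1 + c) * Y * m ^ 2) : ℝ) : ℂ) := by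
    have hy : yCircle t₀ * conj (yCircle t₀) = (Y : ℂ) := yCircle_mul_conj t₀
    simp only [supportDensity, ContinuousMap.add_apply, ContinuousMap.sub_apply,
      ContinuousMap.mul_apply, ContinuousMap.smul_apply, smul_eq_mul, ContinuousMap.star_apply,
      ContinuousMap.pow_apply, ← starRingEnd_apply]
    rw [hy, ← hq, ← hτ, hqq]
    push_cast
    linear_combination (-2 * (Y : ℂ) ^ 3 * (m : ℂ)) * hqq - (2 * Y ^ 3 * (q * conj q)) * hdq -
      (c * (1 + c) * Y ^ 4 * conj d * q ^ 2) * hββ -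
      (c * (1 + c) * Y ^ 4 * (conj d * q + m)) * hdq
  rw [hval, Complex.ofReal_re] at hpos
  have hY3 : 0 < Y ^ 3 := by positivity
  have h1 := nonneg_of_mul_nonneg_right hpos hY3
  have h2 : m ^ 2 * (2 * r' * m ^ 2 - 2 * m - c * (1 + c) * Y) ≥ 0 := by linarith
  have h3 := nonneg_of_mul_nonneg_right h2 (by positivity)
  have h4 : c * (1 + c) * Y = m ^ 2 - 1 := by rw [hmsq, hYdef]; ring
  have h5 : m * (conj d * w).re = (conj q * w).re := by
    rw [← Complex.re_ofReal_mul, hd, map_div₀, Complex.conj_ofReal]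
    congr 1
    field_simp
  rw [hr', h4] at h3
  rw [← h5]
  linarith

/-! ### Geometry of the disk -/

theorem exists_re_fourier_one_eq {u : ℝ} (h0 : 0 < u) (h1 : u < 1) :
    ∃ t : UnitAddCircle, (fourier 1 t : ℂ).re = -1 + 2 * u := by
  set z : ℂ := ⟨-1 + 2 * u, 2 * √(u * (1 - u))⟩ with hz
  have hs : √(u * (1 - u)) ^ 2 = u * (1 - u) := Real.sq_sqrt (by nlinarith)
  have hn : ‖z‖ = 1 := by
    have : ‖z‖ ^ 2 = 1 := by
      rw [Complex.sq_norm, Complex.normSq_apply]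
      simp only [hz]
      linear_combination 4 * hs
    nlinarith [norm_nonneg z]
  obtain ⟨t, ht⟩ := (AddCircle.homeomorphCircle (T := 1) one_ne_zero).surjective
    (Circle.exp z.arg)
  refine ⟨t, ?_⟩
  rw [AddCircle.homeomorphCircle_apply] at ht
  have h := Complex.norm_mul_exp_arg_mul_I z
  rw [hn, Complex.ofReal_one, one_mul] at h
  rw [fourier_one, ht, Circle.coe_exp, h]

/-- Replacing t by -t conjugates q, so averaging the two inequalities removes Im w. -/
theorem two_norm_add_le_re {c : ℝ} (hc : 0 < c) {S₁ S₂ : Submodule ℂ L2Torus}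
    [S₂.HasOrthogonalProjection]
    (hS : IsShiftDecomposition (bigTheta (1 + c) c) S₁ S₂) {w : ℂ} {r : ℝ}
    (hW : closure (numericalRange (compressedShift S₂)) ⊆ Metric.closedBall w r)
    {u : ℝ} (h0 : 0 < u) (h1 : u < 1) :
    ∃ m : ℝ, 0 < m ∧ m ^ 2 = 1 + 4 * (c * (1 + c)) * u ∧
      2 * m + m ^ 2 - 1 ≤ 2 * r * m ^ 2 + 2 * m * ((1 + 2 * c * u) * w.re) := by
  obtain ⟨t, ht⟩ := exists_re_fourier_one_eq h0 h1
  have hneg : (fourier 1 (-t) : ℂ) = conj (fourier 1 t) := by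
    rw [← fourier_neg, fourier_apply, fourier_apply]; simp
  have hqneg : qC c (-t) = conj (qC c t) := by
    rw [qC_apply, qC_apply, hneg]; simp
  have ineq1 := two_norm_add_le hc hS hW t (by linarith)
  have ineq2 := two_norm_add_le hc hS hW (-t) (by rw [hneg, Complex.conj_re]; linarith)
  rw [hqneg, RCLike.norm_conj, Complex.conj_conj] at ineq2
  have hsq := norm_qC_sq c t
  rw [ht] at hsq
  have hre : (qC c t).re = 1 + 2 * c * u := by
    rw [qC_apply]
    simp only [Complex.add_re, Complex.one_re, Complex.ofReal_re, Complex.re_ofReal_mul, ht]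
    ring
  refine ⟨‖qC c t‖, norm_qC_pos hc (by linarith), by linarith, ?_⟩
  · rw [Complex.mul_re, Complex.conj_re, Complex.conj_im] at ineq1
    rw [Complex.mul_re] at ineq2
    rw [← hre]
    linarith

theorem nonpos_of_forall_le_mul {a K : ℝ} (h : ∀ u : ℝ, 0 < u → u ≤ 1 / 2 → a ≤ K * u) :
    a ≤ 0 := by
  have hlim : Tendsto (fun u : ℝ => K * u) (𝓝[>] 0) (𝓝 (K * 0)) :=
    (tendsto_id.const_mul K).mono_left nhdsWithin_le_nhds
  rw [mul_zero] at hlim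
  refine ge_of_tendsto hlim ?_
  filter_upwards [Ioc_mem_nhdsGT (show (0 : ℝ) < 1 / 2 by norm_num)] with u hu
  exact h u hu.1 hu.2

/-- In direction q/m the fibre disk has support value 1 - (m - 1)²/(2m²), short of 1 by order u². If
|w| + r ≤ 1, the averaged support value of D(w, r) is short of 1 by at least order |Re w| u. Letting
u → 0 yields Re w = 0, then r ≥ 1, and so w = 0. -/
theorem center_eq_zero_and_one_le_radius {c : ℝ} (hc : 0 < c) {w : ℂ} {r : ℝ} (hr : ‖w‖ + r ≤ 1)
    (h : ∀ u : ℝ, 0 < u → u < 1 → ∃ m : ℝ, 0 < m ∧ m ^ 2 = 1 + 4 * (c * (1 + c)) * u ∧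
      2 * m + m ^ 2 - 1 ≤ 2 * r * m ^ 2 + 2 * m * ((1 + 2 * c * u) * w.re)) :
    w = 0 ∧ 1 ≤ r := by
  have habs := Complex.abs_re_le_norm w
  have hw : |w.re| ≤ 0 := by
    refine nonpos_of_forall_le_mul (K := 2 * (1 + c) ^ 2) fun u hu hu' => ?_
    obtain ⟨m, hm0, hm, hle⟩ := h u hu (by linarith)
    have hm1 : 1 ≤ m := by
      have : 0 ≤ 4 * (c * (1 + c)) * u := by positivity
      nlinarith
    set k := 1 + 2 * c * u with hk
    have hk0 : 0 < k := by positivity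
    have hdiff : m ^ 2 - k ^ 2 = 4 * c ^ 2 * u * (1 - u) := by rw [hm, hk]; ring
    have hkm : k ≤ m := by
      have : 0 ≤ 4 * c ^ 2 * u * (1 - u) := mul_nonneg (by positivity) (by linarith)
      nlinarith
    have hA : 2 * m * (|w.re| * (m - k)) ≤ (m - 1) ^ 2 := by
      have h1 : 2 * r * m ^ 2 ≤ 2 * (1 - |w.re|) * m ^ 2 := by
        have : r ≤ 1 - |w.re| := by linarith
        gcongr
      have h2 : 2 * m * (k * w.re) ≤ 2 * m * (k * |w.re|) := by
        have := le_abs_self w.re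
        gcongr
      nlinarith
    have hB : c ^ 2 * u ≤ m * (m - k) := by
      have h1 : m ^ 2 - k ^ 2 ≤ 2 * m * (m - k) := by nlinarith
      have h2 : 2 * c ^ 2 * u ≤ 4 * c ^ 2 * u * (1 - u) := by
        have : 0 ≤ c ^ 2 * u * (1 - 2 * u) := mul_nonneg (by positivity) (by linarith)
        linarith
      linarith
    have hC : m - 1 ≤ 2 * (c * (1 + c)) * u := by nlinarith
    have hD : (m - 1) ^ 2 ≤ (2 * (c * (1 + c)) * u) ^ 2 :=
      pow_le_pow_left₀ (by linarith) hC 2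
    have hE : 2 * |w.re| * (c ^ 2 * u) ≤ 2 * |w.re| * (m * (m - k)) := by gcongr
    have hF : (2 * c ^ 2 * u) * |w.re| ≤ (2 * c ^ 2 * u) * (2 * (1 + c) ^ 2 * u) := by
      linarith
    exact le_of_mul_le_mul_left hF (by positivity)
  have hw0 : w.re = 0 := abs_nonpos_iff.1 hw
  have hr1 : 1 - r ≤ 0 := by
    refine nonpos_of_forall_le_mul (K := 4 * (c * (1 + c))) fun u hu hu' => ?_
    obtain ⟨m, hm0, hm, hle⟩ := h u hu (by linarith)
    rw [hw0, mul_zero, mul_zero, add_zero] at hle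
    have hm1 : 1 ≤ m := by
      have : 0 ≤ 4 * (c * (1 + c)) * u := by positivity
      nlinarith
    have h1 : 4 * (c * (1 + c)) * u = m ^ 2 - 1 := by linarith
    rw [h1]
    nlinarith [mul_nonneg (sub_nonneg.2 hm1) (sub_nonneg.2 hm1),
      mul_nonneg (sq_nonneg m) (sq_nonneg (m ^ 2 - 1)), sq_nonneg (m ^ 2 - 1)]
  have hn : ‖w‖ ≤ 0 := by linarith
  exact ⟨norm_le_zero_iff.1 hn, by linarith⟩

theorem norm_add_le_one_of_closedBall_subset {w : ℂ} {r : ℝ} (hr : 0 ≤ r)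
    (h : Metric.closedBall w r ⊆ Metric.closedBall 0 1) : ‖w‖ + r ≤ 1 := by
  by_cases hw : w = 0
  · have : (r : ℂ) ∈ Metric.closedBall w r := by
      rw [hw, mem_closedBall_zero_iff, Complex.norm_real, Real.norm_of_nonneg hr]
    have h1 := h this
    rw [mem_closedBall_zero_iff, Complex.norm_real, Real.norm_of_nonneg hr] at h1
    rw [hw, norm_zero, zero_add]; exact h1
  · have hn : 0 < ‖w‖ := norm_pos_iff.2 hw
    have hu : ‖((r / ‖w‖ : ℝ) : ℂ) * w‖ = r := by
      rw [norm_mul, Complex.norm_real, Real.norm_of_nonneg (by positivity)]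
      field_simp
    have : w + ((r / ‖w‖ : ℝ) : ℂ) * w ∈ Metric.closedBall w r := by
      rw [Metric.mem_closedBall, dist_eq_norm, add_sub_cancel_left, hu]
    have h1 := h this
    have e : w + ((r / ‖w‖ : ℝ) : ℂ) * w = ((1 + r / ‖w‖ : ℝ) : ℂ) * w := by push_cast; ring
    rw [mem_closedBall_zero_iff, e, norm_mul, Complex.norm_real,
      Real.norm_of_nonneg (by positivity)] at h1
    calc ‖w‖ + r = (1 + r / ‖w‖) * ‖w‖ := by field_simp
      _ ≤ 1 := h1

/-! ### Position of the range in the unit disk, and the conclusion. -/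

theorem numericalRange_compressedShift_subset (S : Submodule ℂ L2Torus)
    [S.HasOrthogonalProjection] :
    numericalRange (compressedShift S) ⊆ Metric.closedBall 0 1 := by
  rintro _ ⟨h, hh, rfl⟩
  have hh' : ‖(h : L2Torus)‖ = 1 := hh
  rw [mem_closedBall_zero_iff, inner_compressedShift]
  refine (norm_inner_le_norm _ _).trans ?_
  rw [norm_shift, hh', one_mul]

/-- For unit h, ‖h + z₁h‖² = 2 + 2 Re⟨h, z₁h⟩, which would become arbitrarily small, against the
lower bound for 1 + z₁. -/
theorem neg_one_notMem_closure_numericalRange {c : ℝ} (hc : 0 < c)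
    {S : Submodule ℂ L2Torus} [S.HasOrthogonalProjection]
    (hS : S ≤ modelSpace (bigTheta (1 + c) c)) (hinv : ∀ f ∈ S, shift 1 f ∈ S) :
    (-1 : ℂ) ∉ closure (numericalRange (compressedShift S)) := by
  intro hmem
  obtain ⟨C, hC, hle⟩ := exists_norm_le_mul_norm_add_shift hc hS hinv
  obtain ⟨_, ⟨h, hh, rfl⟩, hdist⟩ := Metric.mem_closure_iff.1 hmem (1 / (2 * C)) (by positivity)
  have hh' : ‖(h : L2Torus)‖ = 1 := hh
  rw [inner_compressedShift, dist_eq_norm] at hdist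
  have h1 := hle h h.2
  rw [norm_add_shift_sq, hh'] at h1
  have h2 : 1 + (inner ℂ (h : L2Torus) (shift 0 h)).re < 1 / (2 * C) := by
    have h3 := (Complex.abs_re_le_norm (-1 - inner ℂ (h : L2Torus) (shift 0 h))).trans_lt hdist
    have h4 := (abs_lt.1 h3).1
    simp only [Complex.sub_re, Complex.neg_re, Complex.one_re] at h4
    linarith
  have h5 : C * (2 * (1 + (inner ℂ (h : L2Torus) (shift 0 h)).re)) < C * (2 * (1 / (2 * C))) := by
    gcongr
  have h6 : C * (2 * (1 / (2 * C))) = 1 := by field_simp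
  linarith

/-- The closed numerical range is never a disk, for the polynomial `1 + c - z₁ + c z₂`. -/
theorem closure_numericalRange_ne_closedBall {c : ℝ} (hc : 0 < c) {S₁ S₂ : Submodule ℂ L2Torus}
    [S₂.HasOrthogonalProjection]
    (hS : IsShiftDecomposition (bigTheta (1 + c) c) S₁ S₂) (w : ℂ) (r : ℝ) :
    closure (numericalRange (compressedShift S₂)) ≠ Metric.closedBall w r := by
  intro hW
  have hr : 0 ≤ r := by
    by_contra! hr
    -- For r < 0 the ball is empty, so it may be replaced by the empty ball of centre 0 and radius
    -- -1, for which the support inequality is absurd.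
    have hW' : closure (numericalRange (compressedShift S₂)) ⊆ Metric.closedBall 0 (-1) := by
      rw [hW, Metric.closedBall_eq_empty.2 hr]; exact Set.empty_subset _
    obtain ⟨m, hm0, hm, hle⟩ := two_norm_add_le_re hc hS hW' (u := 1 / 2) (by norm_num)
      (by norm_num)
    simp only [Complex.zero_re, mul_zero] at hle
    have : 0 < c * (1 + c) := by positivity
    nlinarith
  have hsub : Metric.closedBall w r ⊆ Metric.closedBall 0 1 := by
    rw [← hW]
    exact closure_minimal (numericalRange_compressedShift_subset S₂) Metric.isClosed_closedBall
  obtain ⟨rfl, hr1⟩ := center_eq_zero_and_one_le_radius hc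
    (norm_add_le_one_of_closedBall_subset hr hsub)
    fun u h0 h1 => two_norm_add_le_re hc hS hW.subset h0 h1
  refine neg_one_notMem_closure_numericalRange hc hS.le_modelSpace₂ hS.invariant₂ ?_
  rw [hW, mem_closedBall_zero_iff]
  simpa using hr1

/-- A torus zero gives a = |z₁ - c z₂| ≤ 1 + c. If a < 1 + c, then (s, -s) with s = a/(1 + c) is a
zero in the bidisk. -/
theorem eq_one_add_of_zeros {a c : ℝ} (ha : 0 < a) (hc : 0 < c)
    (hdisk : ∀ z₁ z₂ : ℂ, ‖z₁‖ < 1 → ‖z₂‖ < 1 → poly a c z₁ z₂ ≠ 0)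
    (htorus : ∃ z₁ z₂ : ℂ, ‖z₁‖ = 1 ∧ ‖z₂‖ = 1 ∧ poly a c z₁ z₂ = 0) : a = 1 + c := by
  refine le_antisymm ?_ ?_
  · obtain ⟨z₁, z₂, h1, h2, h⟩ := htorus
    have e : (a : ℂ) = z₁ - c * z₂ := by
      rw [poly, biaffine] at h; linear_combination h
    have := congrArg norm e
    rw [Complex.norm_real, Real.norm_of_nonneg ha.le] at this
    rw [this]
    refine (norm_sub_le _ _).trans ?_
    rw [norm_mul, h1, h2, Complex.norm_real, Real.norm_of_nonneg hc.le, mul_one]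
  · by_contra! hlt
    have hs : a / (1 + c) < 1 := (div_lt_one (by positivity)).2 hlt
    have hn : ‖((a / (1 + c) : ℝ) : ℂ)‖ < 1 := by
      rwa [Complex.norm_real, Real.norm_of_nonneg (by positivity)]
    refine hdisk ((a / (1 + c) : ℝ) : ℂ) (-((a / (1 + c) : ℝ) : ℂ)) hn (by rwa [norm_neg]) ?_
    have hc1 : (1 + c : ℂ) ≠ 0 := by exact_mod_cast (by positivity : (1 + c : ℝ) ≠ 0)
    rw [poly, biaffine]
    push_cast
    field_simp
    ring

end BidiskShift

end

theorem mainTheorem10 (a c : ℝ) (ha : 0 < a) (hc : 0 < c)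
    (hdisk : ∀ z₁ z₂ : ℂ, ‖z₁‖ < 1 → ‖z₂‖ < 1 → BidiskShift.poly a c z₁ z₂ ≠ 0)
    (htorus : ∃ z₁ z₂ : ℂ, ‖z₁‖ = 1 ∧ ‖z₂‖ = 1 ∧ BidiskShift.poly a c z₁ z₂ = 0)
    (S₁ S₂ : Submodule ℂ BidiskShift.L2Torus) [S₂.HasOrthogonalProjection]
    (hS : BidiskShift.IsShiftDecomposition (BidiskShift.bigTheta a c) S₁ S₂)
    (w : ℂ) (r : ℝ) :
    closure (BidiskShift.numericalRange (BidiskShift.compressedShift S₂)) ≠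
      Metric.closedBall w r := by
  obtain rfl := BidiskShift.eq_one_add_of_zeros ha hc hdisk htorus
  exact BidiskShift.closure_numericalRange_ne_closedBall hc hS w r
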